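/- A pentagon is a region of the Euclidean plane bounded by a simple closed polygonal path with five vertices; it is called non-convex if at least one of its interior angles is greater than $\pi$. Let $\Lambda\subset\mathbb R^2$ be a lattice, and suppose that the flat torus $\mathbb R^2/\Lambda$ is tiled by $N$ pentagons, each of area $1$, edge-to-edge (that is, different tiles meet only along common entire edges or at common vertices). Here different tiles means different tiles of the $\Lambda$-periodic lift of the tiling to the plane. Suppose that every tile is either non-convex or has all five of its interior angles strictly between $\pi/2$ and $2\pi/3$. Then $$\frac{\text{perimeter of the tiling}}{N} \;>\; \tfrac12 P ,$$ where the perimeter of the tiling is the total length of its edges on the torus, each edge counted once, and $P=2\sqrt{2+\sqrt3}$ is the perimeter of the unit-area Prismatic pentagon, i.e. of the pentagon of area $1$ that is circumscribed about a circle and has two adjacent right angles and three angles equal to $2\pi/3$. -/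

import Mathlib

open MeasureTheory Set

noncomputable section

/-- The perimeter of a pentagon in the Euclidean plane `ℂ`: the sum of its five side lengths. -/
def Polygon.pentagonPerimeter (p : Polygon ℂ 5) : ℝ :=
  ∑ k, dist (p k) (p (finRotate 5 k))

/-- The closed polygonal path through the five vertices is simple: the vertices are distinct, and
two different sides meet at most in a common endpoint of two consecutive sides. -/
def Polygon.IsSimplePentagon (p : Polygon ℂ 5) : Prop :=
  Function.Injective p.vertices ∧
    ∀ k l : Fin 5, k ≠ l → ∀ z ∈ p.edgeSet ℝ k ∩ p.edgeSet ℝ l,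
      (l = finRotate 5 k ∧ z = p l) ∨ (k = finRotate 5 l ∧ z = p k)

/-- A (solid, simple, not necessarily convex) pentagon: a simple closed pentagonal path in the
plane `ℂ`, together with the region that it encloses. The region is characterized as the compact
set that is the closure of its interior and whose topological boundary is the path (by the
Jordan curve theorem, there is exactly one such set for each simple path). -/
structure Pentagon where
  /-- the boundary path -/
  poly : Polygon ℂ 5
  /-- the closed region bounded by the path -/
  carrier : Set ℂ
  isSimple : poly.IsSimplePentagon
  isCompact : IsCompact carrier
  closure_interior : closure (interior carrier) = carrier
  frontier_eq : frontier carrier = poly.boundary ℝ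

/-- The plane region `S` has interior angle `θ ∈ (0, 2π)` at the point `v`: close to `v`, the
region is exactly a closed circular sector with apex `v` and opening `θ`, where the sector starts
in the direction of the unit vector `u` and extends counterclockwise. -/
def HasInteriorAngle (S : Set ℂ) (v : ℂ) (θ : ℝ) : Prop :=
  0 < θ ∧ θ < 2 * Real.pi ∧
    ∃ u : ℂ, ‖u‖ = 1 ∧ ∃ ε : ℝ, 0 < ε ∧
      ∀ r φ : ℝ, 0 < r → r < ε → 0 ≤ φ → φ < 2 * Real.pi →
        (v + r * u * Complex.exp (φ * Complex.I) ∈ S ↔ φ ≤ θ)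

namespace Pentagon

/-- A pentagon is non-convex if one of its interior angles is greater than `π`. -/
def IsNonconvex (P : Pentagon) : Prop :=
  ∃ k θ, HasInteriorAngle P.carrier (P.poly k) θ ∧ Real.pi < θ

/-- All five interior angles of the pentagon lie strictly between `α` and `β`. -/
def AnglesStrictlyBetween (P : Pentagon) (α β : ℝ) : Prop :=
  ∀ k, ∃ θ, HasInteriorAngle P.carrier (P.poly k) θ ∧ α < θ ∧ θ < β

end Pentagon

/-- The translate of a plane set by the vector `t`. -/
def translateSet (t : ℂ) (S : Set ℂ) : Set ℂ := (fun z => t + z) '' S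

/-- An edge-to-edge tiling of the flat torus `ℂ / Λ` by `N` pentagons, described by its
`Λ`-periodic lift to the plane: each tile of the torus is the image of a plane pentagon `tile i`,
and the tiles of the lift are the translates `t + tile i` with `i : Fin N` and `t ∈ Λ`. -/
structure TorusTiling (Λ : Submodule ℤ ℂ) (N : ℕ) where
  tile : Fin N → Pentagon
  /-- the tiles cover the torus -/
  covers : ∀ z : ℂ, ∃ i, ∃ t ∈ Λ, z ∈ translateSet t (tile i).carrier
  /-- different tiles of the lift have disjoint interiors -/
  interiors_disjoint : ∀ i j, ∀ t ∈ Λ, ¬(i = j ∧ t = 0) →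
    Disjoint (interior (tile i).carrier) (interior (translateSet t (tile j).carrier))
  /-- different tiles of the lift meet only along common entire edges or at common vertices -/
  edge_to_edge : ∀ i j, ∀ t ∈ Λ, ¬(i = j ∧ t = 0) →
    ∀ z ∈ (tile i).carrier ∩ translateSet t (tile j).carrier,
      (∃ k l, z = (tile i).poly k ∧ z = t + (tile j).poly l) ∨
      (∃ k l, z ∈ (tile i).poly.edgeSet ℝ k ∧
        (tile i).poly.edgeSet ℝ k = translateSet t ((tile j).poly.edgeSet ℝ l))

namespace TorusTiling

variable {Λ : Submodule ℤ ℂ} {N : ℕ}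

/-- Side number `e.2` of tile number `e.1`, as a segment in the plane. -/
def side (T : TorusTiling Λ N) (e : Fin N × Fin 5) : Set ℂ :=
  (T.tile e.1).poly.edgeSet ℝ e.2

/-- The length of a side of a tile. -/
def sideLength (T : TorusTiling Λ N) (e : Fin N × Fin 5) : ℝ :=
  dist ((T.tile e.1).poly e.2) ((T.tile e.1).poly (finRotate 5 e.2))

theorem diam_side (T : TorusTiling Λ N) (e : Fin N × Fin 5) :
    Metric.diam (T.side e) = T.sideLength e := by
  unfold side sideLength Polygon.edgeSet
  rw [affineSegment_eq_segment, ← convexHull_pair, convexHull_diam, Metric.diam_pair]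

/-- Two sides of tiles are the same edge of the tiling of the torus if they differ by a
translation in `Λ`. -/
def sameEdge (T : TorusTiling Λ N) : Setoid (Fin N × Fin 5) where
  r e f := ∃ t ∈ Λ, T.side f = translateSet t (T.side e)
  iseqv :=
    { refl := fun e => ⟨0, Λ.zero_mem, by simp [translateSet]⟩
      symm := by
        rintro e f ⟨t, ht, h⟩
        refine ⟨-t, Λ.neg_mem ht, ?_⟩
        rw [h, translateSet, translateSet, image_image]
        simp
      trans := by
        rintro e f g ⟨t, ht, h⟩ ⟨s, hs, h'⟩
        refine ⟨s + t, Λ.add_mem hs ht, ?_⟩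
        rw [h', h, translateSet, translateSet, translateSet, image_image]
        simp only [add_assoc] }

/-- The type of edges of the tiling of the torus. -/
def Edge (T : TorusTiling Λ N) : Type := Quotient T.sameEdge

/-- The length of an edge of the tiling. -/
def edgeLength (T : TorusTiling Λ N) : T.Edge → ℝ :=
  Quotient.lift T.sideLength (by
    rintro e f ⟨t, -, h⟩
    rw [← T.diam_side e, ← T.diam_side f, h]
    exact ((isometry_add_left t).diam_image _).symm)

/-- The perimeter of the tiling: the total length of its (finitely many) edges, where each edge is
counted once. -/
def perimeter (T : TorusTiling Λ N) : ℝ := ∑ᶠ e : T.Edge, T.edgeLength e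

/-- The perimeter per tile. -/
def perimeterPerTile (T : TorusTiling Λ N) : ℝ := T.perimeter / N

end TorusTiling

/-- The inradius of the unit-area Prismatic pentagon (`r * perimeter / 2 = 1`). -/
def prismaticInradius : ℝ := 1 / √(2 + √3)

/-- The unit-area Prismatic pentagon: the convex pentagon with two adjacent right angles and three
angles `2π/3` that is circumscribed about a circle (here with centre `0` and radius
`prismaticInradius`) and has area `1`. It is unique up to isometry. -/
def prismaticPentagon : Polygon ℂ 5 where
  vertices :=
    let r := prismaticInradius
    ![⟨-r, -r⟩, ⟨r, -r⟩, ⟨r, r / √3⟩, ⟨0, 2 * r / √3⟩, ⟨-r, r / √3⟩]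

theorem prismaticPentagon_perimeter :
    prismaticPentagon.pentagonPerimeter = 2 * √(2 + √3) := by
  have h3 : (√3 : ℝ) ^ 2 = 3 := Real.sq_sqrt (by norm_num)
  have hs : 0 < √(3 : ℝ) := by positivity
  have hR : (√(2 + √3) : ℝ) ^ 2 = 2 + √3 := Real.sq_sqrt (by positivity)
  have hRp : 0 < √(2 + √3) := by positivity
  have hr : 0 < prismaticInradius := by unfold prismaticInradius; positivity
  have key : ∀ a b c d L : ℝ, 0 ≤ L → (a - c) ^ 2 + (b - d) ^ 2 = L ^ 2 →
      dist (⟨a, b⟩ : ℂ) ⟨c, d⟩ = L := by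
    intro a b c d L hL h
    rw [Complex.dist_eq_re_im]
    simp only
    rw [h, Real.sqrt_sq hL]
  have hrot : ∀ k : Fin 5, finRotate 5 k = k + 1 := by decide
  have hsum : prismaticPentagon.pentagonPerimeter =
      prismaticInradius * (4 + 6 / √3) := by
    unfold Polygon.pentagonPerimeter
    simp only [hrot, Fin.sum_univ_five]
    change dist (⟨-prismaticInradius, -prismaticInradius⟩ : ℂ)
        ⟨prismaticInradius, -prismaticInradius⟩ +
      dist (⟨prismaticInradius, -prismaticInradius⟩ : ℂ)
        ⟨prismaticInradius, prismaticInradius / √3⟩ +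
      dist (⟨prismaticInradius, prismaticInradius / √3⟩ : ℂ)
        ⟨0, 2 * prismaticInradius / √3⟩ +
      dist (⟨0, 2 * prismaticInradius / √3⟩ : ℂ)
        ⟨-prismaticInradius, prismaticInradius / √3⟩ +
      dist (⟨-prismaticInradius, prismaticInradius / √3⟩ : ℂ)
        ⟨-prismaticInradius, -prismaticInradius⟩ = _
    rw [key _ _ _ _ (2 * prismaticInradius) (by positivity) (by ring),
      key _ _ _ _ (prismaticInradius * (1 + 1 / √3)) (by positivity) (by ring),
      key _ _ _ _ (2 * prismaticInradius / √3) (by positivity)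
        (by field_simp; rw [h3]; ring),
      key _ _ _ _ (2 * prismaticInradius / √3) (by positivity)
        (by field_simp; rw [h3]; ring),
      key _ _ _ _ (prismaticInradius * (1 + 1 / √3)) (by positivity) (by ring)]
    ring
  rw [hsum]
  unfold prismaticInradius
  field_simp
  nlinarith [hR, h3]

end

/-! # Perimeter of pentagonal tilings of flat tori -/

/-! Since each edge of the tiling is a side of at most two tiles (`sum_pentagonPerimeter_le`), the
perimeter of the tiling is at least half the sum of the tile perimeters, so it suffices that the
average tile perimeter exceeds `P`, which is about 3.8637. Three facts give this.

A nonconvex tile has perimeter at least 4. Its reflex vertex lies in the hull of the other four, so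
the tile lies in the hull of a closed quadrilateral path that is no longer than the boundary, and
the square is optimal for such hulls (`volume_convexHull_four_le`).

Any other tile has perimeter above 3.8115, just below that of the regular pentagon. The angle window
forces all turns of its boundary to have the same sign (`turning_same_sign`), so the path is convex
and the tile area is at most its signed area up to orientation. For signed area,
`signedArea_le_closedLength_sq` is the pentagonal isoperimetric inequality, obtained from equal
sides and a discrete Wirtinger inequality.

Tiles of the second kind lie below `P`, but they cannot be too numerous. A vertex surrounded only by
angles in `(π/2, 2π/3)` would need more than three and fewer than four corners, so every vertex
meets a nonconvex tile. Count 1 for each corner of a tile of the second kind and 2 for one reflex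
corner of each nonconvex tile: an angle of total weight `m` exceeds `mπ/2`, so a vertex carries
weight at most 3, hence at most 3 times its number of nonconvex corners. Summing over vertices, with
`C` and `M` tiles of the two kinds, `5C + 2M ≤ 15M` (`card_convex_le`). The average perimeter is
then at least `(13 · 3.8115 + 5 · 4) / 18 > 3.8638`. -/

/-! ### Cross products and areas of triangles. -/

/-- The cross product (signed area of the parallelogram) of two plane vectors. -/
def planeCross (a b : ℂ) : ℝ := a.re * b.im - a.im * b.re

theorem abs_planeCross_le (a b : ℂ) : |planeCross a b| ≤ ‖a‖ * ‖b‖ := by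
  have h : planeCross a b = ((starRingEnd ℂ a) * b).im := by simp [planeCross]; ring
  rw [h]
  refine (Complex.abs_im_le_norm _).trans ?_
  simp

/-- The closed standard triangle in the plane. -/
def unitTriangle : Set ℂ := {z | 0 ≤ z.re ∧ 0 ≤ z.im ∧ z.re + z.im ≤ 1}

theorem convex_unitTriangle : Convex ℝ unitTriangle := by
  rintro x ⟨h1, h2, h3⟩ y ⟨h4, h5, h6⟩ a b ha hb hab
  simp only [unitTriangle, mem_ofPred_eq, Complex.add_re, Complex.add_im, Complex.real_smul,
    Complex.re_ofReal_mul, Complex.im_ofReal_mul]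
  refine ⟨by positivity, by positivity, ?_⟩
  nlinarith

theorem volume_unitTriangle_le : volume unitTriangle ≤ ENNReal.ofReal (1 / 2) := by
  have hm : MeasurableSet {p : ℝ × ℝ | 0 ≤ p.1 ∧ 0 ≤ p.2 ∧ p.1 + p.2 ≤ 1} := by measurability
  have h : unitTriangle = Complex.measurableEquivRealProd ⁻¹'
      {p : ℝ × ℝ | 0 ≤ p.1 ∧ 0 ≤ p.2 ∧ p.1 + p.2 ≤ 1} := by
    ext z; simp [unitTriangle, Complex.measurableEquivRealProd_apply]
  rw [h, Complex.volume_preserving_equiv_real_prod.measure_preimage hm.nullMeasurableSet,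
    Measure.volume_eq_prod, Measure.prod_apply hm]
  calc _ ≤ ∫⁻ x : ℝ, (Icc (0 : ℝ) 1).indicator (fun x => ENNReal.ofReal (1 - x)) x := by
        refine lintegral_mono fun x => ?_
        by_cases hx : x ∈ Icc (0 : ℝ) 1
        · rw [indicator_of_mem hx, ← sub_zero (1 - x), ← Real.volume_Icc]
          exact measure_mono fun y hy => ⟨hy.2.1, by have := hy.2.2; simp at this; linarith⟩
        · rw [indicator_of_notMem hx]
          have : Prod.mk x ⁻¹' {p : ℝ × ℝ | 0 ≤ p.1 ∧ 0 ≤ p.2 ∧ p.1 + p.2 ≤ 1} = ∅ := by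
            ext y
            simp only [mem_preimage, mem_ofPred_eq, mem_empty_iff_false, iff_false]
            rintro ⟨h1, h2, h3⟩
            exact hx ⟨h1, by linarith⟩
          simp [this]
    _ = ∫⁻ x in Icc (0 : ℝ) 1, ENNReal.ofReal (1 - x) := lintegral_indicator measurableSet_Icc _
    _ = ENNReal.ofReal (∫ x in Icc (0 : ℝ) 1, (1 - x)) := by
        rw [ofReal_integral_eq_lintegral_ofReal]
        · exact (by fun_prop : Continuous fun x : ℝ => 1 - x).continuousOn.integrableOn_Icc
        · filter_upwards [ae_restrict_mem measurableSet_Icc] with x hx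
          simpa using hx.2
    _ ≤ ENNReal.ofReal (1 / 2) := by
        refine ENNReal.ofReal_le_ofReal (le_of_eq ?_)
        rw [integral_Icc_eq_integral_Ioc, ← intervalIntegral.integral_of_le zero_le_one,
          intervalIntegral.integral_sub (by simp) (by simp)]
        simp; norm_num

/-- The area of a triangle is at most half the absolute value of the cross product of two sides. -/
theorem volume_triangle_le (a b c : ℂ) :
    volume (convexHull ℝ {a, b, c}) ≤ ENNReal.ofReal (|planeCross (b - a) (c - a)| / 2) := by
  set M : Matrix (Fin 2) (Fin 2) ℝ :=
    !![(b - a).re, (c - a).re; (b - a).im, (c - a).im] with hM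
  set f : ℂ →ₗ[ℝ] ℂ := Matrix.toLin Complex.basisOneI Complex.basisOneI M with hf
  have hdet : LinearMap.det f = planeCross (b - a) (c - a) := by
    rw [hf, LinearMap.det_toLin, hM, Matrix.det_fin_two_of, planeCross]; ring
  have hfz (z : ℂ) : f z = z.re • (b - a) + z.im • (c - a) := by
    rw [hf, Matrix.toLin_apply]
    apply Complex.ext <;>
    simp [Fin.sum_univ_two, Matrix.mulVec, dotProduct, hM] <;> ring
  have hsub : convexHull ℝ {a, b, c} ⊆ (fun z => a + z) '' (f '' unitTriangle) := by
    apply convexHull_min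
    · have h0 : ∀ z ∈ unitTriangle, a + f z ∈ (fun z => a + z) '' (f '' unitTriangle) :=
        fun z hz => mem_image_of_mem _ (mem_image_of_mem _ hz)
      rintro z (rfl | rfl | rfl)
      · simpa using h0 0 (by simp [unitTriangle])
      · simpa [hfz] using h0 1 (by simp [unitTriangle])
      · simpa [hfz] using h0 Complex.I (by simp [unitTriangle])
    · exact (convex_unitTriangle.linear_image f).translate a
  refine (measure_mono hsub).trans ?_
  rw [image_add_left, measure_preimage_add, Measure.addHaar_image_linearMap, hdet]
  calc _ ≤ ENNReal.ofReal |planeCross (b - a) (c - a)| * ENNReal.ofReal (1 / 2) := by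
        gcongr; exact volume_unitTriangle_le
    _ = _ := by rw [← ENNReal.ofReal_mul (abs_nonneg _)]; congr 1; ring

/-- The area of a triangle is at most half the product of two of its sides. -/
theorem volume_triangle_le_dist_mul_dist (a b c : ℂ) :
    volume (convexHull ℝ {a, b, c}) ≤ ENNReal.ofReal (dist a b * dist b c / 2) := by
  have h := volume_triangle_le b a c
  rw [Set.insert_comm] at h
  refine h.trans (ENNReal.ofReal_le_ofReal ?_)
  have := abs_planeCross_le (a - b) (c - b)
  rw [dist_eq_norm, dist_comm b c, dist_eq_norm]
  linarith

/-- Points on the inner side of all three sides of a positively oriented triangle belong to it. -/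
theorem mem_triangle_of_planeCross_nonneg {a b c x : ℂ} (h : 0 < planeCross (b - a) (c - a))
    (ha : 0 ≤ planeCross (b - a) (x - a)) (hb : 0 ≤ planeCross (c - b) (x - b))
    (hc : 0 ≤ planeCross (a - c) (x - c)) : x ∈ convexHull ℝ {a, b, c} := by
  set D := planeCross (b - a) (c - a) with hD
  -- Barycentric coordinates: each weight is the area of the subtriangle opposite a vertex, divided
  -- by the total area.
  have hx : x = (planeCross (c - b) (x - b) / D) • a + ((planeCross (a - c) (x - c) / D) • b +
      (planeCross (b - a) (x - a) / D) • c) := by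
    apply Complex.ext <;>
    simp only [Complex.add_re, Complex.add_im, Complex.real_smul,
      Complex.re_ofReal_mul, Complex.im_ofReal_mul] <;> field_simp <;>
    simp only [hD, planeCross, Complex.sub_re, Complex.sub_im] <;> ring
  have hs : planeCross (c - b) (x - b) / D + planeCross (a - c) (x - c) / D +
      planeCross (b - a) (x - a) / D = 1 := by
    field_simp
    simp only [hD, planeCross, Complex.sub_re, Complex.sub_im]; ring
  rw [hx, ← add_assoc]
  have hC : Convex ℝ (convexHull ℝ {a, b, c}) := convex_convexHull ℝ _
  have hm : ∀ y ∈ ({a, b, c} : Set ℂ), y ∈ convexHull ℝ {a, b, c} := subset_convexHull ℝ _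
  have := hC.sum_mem (t := Finset.univ) (w := ![planeCross (c - b) (x - b) / D,
    planeCross (a - c) (x - c) / D, planeCross (b - a) (x - a) / D]) (z := ![a, b, c])
    (by simp [Fin.forall_fin_succ]; refine ⟨?_, ?_, ?_⟩ <;> positivity)
    (by simpa [Fin.sum_univ_three] using hs)
    (by simp [Fin.forall_fin_succ]; exact ⟨hm _ (by simp), hm _ (by simp), hm _ (by simp)⟩)
  simpa [Fin.sum_univ_three] using this

/-- The hull of a set on the left of a directed line is on the left of that line. -/
theorem planeCross_nonneg_of_mem_convexHull {S : Set ℂ} {u v x : ℂ}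
    (hS : ∀ y ∈ S, 0 ≤ planeCross u (y - v)) (hx : x ∈ convexHull ℝ S) :
    0 ≤ planeCross u (x - v) := by
  have hc : Convex ℝ {y | 0 ≤ planeCross u (y - v)} := by
    intro y hy z hz a b ha hb hab
    simp only [mem_ofPred_eq, planeCross, Complex.sub_re, Complex.sub_im] at hy hz
    simp only [mem_ofPred_eq, planeCross, Complex.sub_re, Complex.sub_im, Complex.add_re,
      Complex.add_im, Complex.real_smul, Complex.re_ofReal_mul, Complex.im_ofReal_mul]
    obtain rfl : a = 1 - b := by linarith
    nlinarith [mul_nonneg ha hy, mul_nonneg hb hz]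
  exact convexHull_min hS hc hx

/-! ### The isoperimetric inequality for closed pentagonal paths. -/

/-- The signed area enclosed by a closed pentagonal path. -/
noncomputable def signedArea (q : Fin 5 → ℂ) : ℝ := (∑ k, planeCross (q k) (q (k + 1))) / 2

/-- The length of a closed pentagonal path. -/
noncomputable def closedLength (q : Fin 5 → ℂ) : ℝ := ∑ k, dist (q k) (q (k + 1))

/-- The sum of the squared side lengths of a closed pentagonal path. -/
noncomputable def sumSqSides (q : Fin 5 → ℂ) : ℝ := ∑ k, dist (q k) (q (k + 1)) ^ 2

/-- A pentagon whose sides turn left at most by a straight angle in two consecutive steps has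
convex hull of area at most its signed area. -/
theorem volume_convexHull_le_signedArea {q : Fin 5 → ℂ}
    (h1 : ∀ k, 0 < planeCross (q (k + 1) - q k) (q (k + 2) - q (k + 1)))
    (h2 : ∀ k, 0 < planeCross (q (k + 1) - q k) (q (k + 3) - q (k + 2))) :
    volume (convexHull ℝ (range q)) ≤ ENNReal.ofReal (signedArea q) := by
  -- Every vertex lies on the left of every side. Offsets 0 and 1 lie on the side itself, 2 uses `h1
  -- k`, 3 adds `h2 k`, and 4 uses the turn at the start of the side, `h1 (k + 4)`.
  have edge : ∀ k, ∀ x ∈ convexHull ℝ (range q),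
      0 ≤ planeCross (q (k + 1) - q k) (x - q k) := by
    intro k x hx
    refine planeCross_nonneg_of_mem_convexHull ?_ hx
    rintro _ ⟨j, rfl⟩
    obtain ⟨i, rfl⟩ : ∃ i, j = k + i := ⟨j - k, (add_sub_cancel k j).symm⟩
    have e1 := h1 k
    have e2 := h2 k
    have e3 := h1 (k + 4)
    have r1 : k + 4 + 1 = k := by rw [add_assoc]; simp
    have r2 : k + 4 + 2 = k + 1 := by rw [add_assoc]; rfl
    rw [r1, r2] at e3
    simp only [planeCross, Complex.sub_re, Complex.sub_im] at *
    fin_cases i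
    · simp
    · apply le_of_eq; simp; ring
    · simp; nlinarith
    · simp; nlinarith
    · simp; nlinarith
  have a0 := h1 0
  have a1 := h1 1
  have a3 := h1 3
  have b0 := h2 0
  simp only [Fin.isValue, Fin.reduceAdd] at a0 a1 a3 b0
  have p1 : 0 < planeCross (q 1 - q 0) (q 2 - q 0) := by
    simp only [planeCross, Complex.sub_re, Complex.sub_im] at *; nlinarith
  have p2 : 0 < planeCross (q 2 - q 0) (q 3 - q 0) := by
    simp only [planeCross, Complex.sub_re, Complex.sub_im] at *; nlinarith
  have p3 : 0 < planeCross (q 3 - q 0) (q 4 - q 0) := by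
    simp only [planeCross, Complex.sub_re, Complex.sub_im] at *; nlinarith
  have swap : ∀ u v x : ℂ, planeCross (u - v) (x - v) = -planeCross (v - u) (x - u) := by
    intro u v x; simp only [planeCross, Complex.sub_re, Complex.sub_im]; ring
  -- Fan triangulation from `q 0`: the signs with respect to the two diagonals at `q 0` select the
  -- triangle containing `x`.
  have hsub : convexHull ℝ (range q) ⊆ convexHull ℝ {q 0, q 1, q 2} ∪
      (convexHull ℝ {q 0, q 2, q 3} ∪ convexHull ℝ {q 0, q 3, q 4}) := by
    intro x hx
    have e0 := edge 0 x hx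
    have e1 := edge 1 x hx
    have e2 := edge 2 x hx
    have e3 := edge 3 x hx
    have e4 := edge 4 x hx
    simp only [Fin.isValue, Fin.reduceAdd] at e0 e1 e2 e3 e4
    rcases le_total (planeCross (q 2 - q 0) (x - q 0)) 0 with s | s
    · exact Or.inl (mem_triangle_of_planeCross_nonneg p1 e0 e1 (by rw [swap]; linarith))
    rcases le_total (planeCross (q 3 - q 0) (x - q 0)) 0 with s' | s'
    · exact Or.inr (Or.inl (mem_triangle_of_planeCross_nonneg p2 s e2 (by rw [swap]; linarith)))
    · exact Or.inr (Or.inr (mem_triangle_of_planeCross_nonneg p3 s' e3 e4))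
  refine (measure_mono hsub).trans <| (measure_union_le _ _).trans <|
    (add_le_add le_rfl (measure_union_le _ _)).trans <|
    (add_le_add (volume_triangle_le _ _ _)
    (add_le_add (volume_triangle_le _ _ _) (volume_triangle_le _ _ _))).trans ?_
  rw [abs_of_pos p1, abs_of_pos p2, abs_of_pos p3,
    ← ENNReal.ofReal_add (by positivity) (by positivity),
    ← ENNReal.ofReal_add (by positivity) (by positivity)]
  refine ENNReal.ofReal_le_ofReal (le_of_eq ?_)
  simp only [signedArea, Fin.sum_univ_five, planeCross, Complex.sub_re, Complex.sub_im,
    Fin.isValue, Fin.reduceAdd, zero_add]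
  ring

theorem dist_sq_eq (a b : ℂ) : dist a b ^ 2 = (a.re - b.re) ^ 2 + (a.im - b.im) ^ 2 := by
  rw [dist_eq_norm, Complex.sq_norm, Complex.normSq_apply]; simp; ring

/-- The discrete Wirtinger inequality for closed pentagonal paths; the constant is
`tan (π / 5) = √(5 - 2 * √5)`. -/
theorem signedArea_le_sumSqSides (q : Fin 5 → ℂ) :
    4 * √(5 - 2 * √5) * signedArea q ≤ sumSqSides q := by
  set s := √(5 : ℝ) with hs
  have s2 : s ^ 2 = 5 := Real.sq_sqrt (by norm_num)
  have sl : 2.2 < s := by rw [hs]; apply Real.lt_sqrt_of_sq_lt; norm_num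
  have su : s < 2.3 := by rw [hs, Real.sqrt_lt' (by norm_num)]; norm_num
  set t := √(5 - 2 * s) with ht
  have t2 : t ^ 2 = 5 - 2 * s := Real.sq_sqrt (by linarith)
  -- With `q 0` as origin, the difference of the two sides is a tridiagonal Hermitian form in the
  -- other four vertices, with diagonal entries 2 and off-diagonal entries of squared modulus `1 + t
  -- ^ 2`. It is diagonalized by completing squares; `c` is the current pivot.
  have key : ∀ c X Y X' Y' : ℝ, 0 < c →
      0 ≤ c * (X ^ 2 + Y ^ 2) + (1 + t ^ 2) / c * (X' ^ 2 + Y' ^ 2) - 2 * (X * X' + Y * Y')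
        - 2 * t * (X * Y' - Y * X') := by
    intro c X Y X' Y' hc
    have : c * (X ^ 2 + Y ^ 2) + (1 + t ^ 2) / c * (X' ^ 2 + Y' ^ 2) - 2 * (X * X' + Y * Y')
        - 2 * t * (X * Y' - Y * X') =
        c * ((X - (X' + t * Y') / c) ^ 2 + (Y - (Y' - t * X') / c) ^ 2) := by
      field_simp; ring
    rw [this]; positivity
  -- The pivots obey `c' = 2 - (1 + t ^ 2) / c`. Starting from 2 they are `s - 1`, `3 - s` and
  -- finally 0, so three squares exhaust the form and the constant is sharp.
  have d1 : (1 + t ^ 2) / 2 = 3 - s := by rw [t2]; ring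
  have d2 : (1 + t ^ 2) / (s - 1) = s - 1 := by
    rw [t2, div_eq_iff (by linarith)]; linarith
  have d3 : (1 + t ^ 2) / (3 - s) = 2 := by
    rw [t2, div_eq_iff (by linarith)]; ring
  have k1 := key 2 ((q 1).re - (q 0).re) ((q 1).im - (q 0).im)
    ((q 2).re - (q 0).re) ((q 2).im - (q 0).im) (by norm_num)
  have k2 := key (s - 1) ((q 2).re - (q 0).re) ((q 2).im - (q 0).im)
    ((q 3).re - (q 0).re) ((q 3).im - (q 0).im) (by linarith)
  have k3 := key (3 - s) ((q 3).re - (q 0).re) ((q 3).im - (q 0).im)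
    ((q 4).re - (q 0).re) ((q 4).im - (q 0).im) (by linarith)
  rw [d1] at k1
  rw [d2] at k2
  rw [d3] at k3
  have k := add_nonneg (add_nonneg k1 k2) k3
  rw [← sub_nonneg]
  refine k.trans (le_of_eq ?_)
  simp only [signedArea, sumSqSides, Fin.sum_univ_five, Fin.isValue, Fin.reduceAdd, zero_add,
    dist_sq_eq, planeCross]
  ring

/-- Among triangles with given base and given sum of the other two sides, the isosceles one has
the largest area. -/
theorem exists_isosceles (a b c : ℂ) : ∃ b' : ℂ,
    dist a b' = (dist a b + dist b c) / 2 ∧ dist b' c = (dist a b + dist b c) / 2 ∧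
    planeCross a b + planeCross b c ≤ planeCross a b' + planeCross b' c := by
  set x := dist a b with hx
  set y := dist b c with hy
  have x0 : 0 ≤ x := dist_nonneg
  have y0 : 0 ≤ y := dist_nonneg
  by_cases hac : a = c
  · subst hac
    -- When the base degenerates both cross product sums vanish, so any point at the right distance
    -- serves as apex.
    have hn : ‖((x : ℂ) + y) / 2‖ = (x + y) / 2 := by
      rw [← Complex.ofReal_add, norm_div, Complex.norm_real, Real.norm_of_nonneg (by positivity)]
      simp
    refine ⟨a + (x + y) / 2, ?_, ?_, ?_⟩
    · rw [dist_comm, dist_eq_norm, add_sub_cancel_left, hn]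
    · rw [dist_eq_norm, add_sub_cancel_left, hn]
    · simp only [planeCross]; linarith
  set d := dist a c with hd
  have d0 : 0 < d := dist_pos.2 hac
  have tri : d ≤ x + y := dist_triangle a b c
  have xd : x ^ 2 = _ := dist_sq_eq a b
  have yd : y ^ 2 = _ := dist_sq_eq b c
  have dd : d ^ 2 = _ := dist_sq_eq a c
  set h := √((x + y) ^ 2 - d ^ 2) / 2 with hh
  have h0 : 0 ≤ h := by positivity
  have h2 : h ^ 2 = ((x + y) ^ 2 - d ^ 2) / 4 := by
    rw [hh, div_pow, Real.sq_sqrt (by nlinarith)]; norm_num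
  have heron : planeCross (b - a) (c - a) ≤ h * d := by
    refine (le_abs_self _).trans (abs_le_of_sq_le_sq ?_ (by positivity))
    -- Heron's formula. With `x + y` and `d` fixed, the right side is largest for `x = y`.
    have e : 4 * planeCross (b - a) (c - a) ^ 2 =
        ((x + y) ^ 2 - d ^ 2) * (d ^ 2 - (x - y) ^ 2) := by
      have : ((x + y) ^ 2 - d ^ 2) * (d ^ 2 - (x - y) ^ 2) =
          2 * d ^ 2 * (x ^ 2 + y ^ 2) - (x ^ 2 - y ^ 2) ^ 2 - d ^ 2 * d ^ 2 := by ring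
      rw [this, xd, yd, dd]
      simp only [planeCross, Complex.sub_re, Complex.sub_im]; ring
    have e' : 0 ≤ (x + y) ^ 2 - d ^ 2 := by nlinarith
    rw [mul_pow, h2]
    linarith [mul_nonneg e' (sq_nonneg (x - y))]
  set w : ℂ := c - a with hw
  have hwd : w.re ^ 2 + w.im ^ 2 = d ^ 2 := by rw [dd, hw]; simp; ring
  -- The apex at height `h` above the midpoint of the base, on the side where the signed area is
  -- positive.
  set b' : ℂ := ⟨a.re + w.re / 2 + h / d * w.im, a.im + w.im / 2 - h / d * w.re⟩ with hb'
  have hca : c = a + w := by simp [hw]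
  have hsq : d ^ 2 / 4 + h ^ 2 = ((x + y) / 2) ^ 2 := by rw [h2]; ring
  refine ⟨b', ?_, ?_, ?_⟩
  · rw [← sq_eq_sq₀ dist_nonneg (by positivity), dist_sq_eq, ← hsq, hb']
    field_simp
    linear_combination 4 * (d ^ 2 + 4 * h ^ 2) * hwd
  · rw [← sq_eq_sq₀ dist_nonneg (by positivity), dist_sq_eq, ← hsq, hb', hca]
    simp only [Complex.add_re, Complex.add_im]
    field_simp
    linear_combination 4 * (d ^ 2 + 4 * h ^ 2) * hwd
  · have e : planeCross a b' + planeCross b' c - (planeCross a b + planeCross b c) =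
        h * d - planeCross (b - a) w := by
      have : h * d = h / d * (w.re ^ 2 + w.im ^ 2) := by rw [hwd]; field_simp
      rw [this, hb', hca]
      simp only [planeCross, Complex.add_re, Complex.add_im, Complex.sub_re, Complex.sub_im]
      ring
    linarith

theorem dist_le_closedLength (q : Fin 5 → ℂ) (k : Fin 5) : dist (q k) (q 0) ≤ closedLength q := by
  have n0 : 0 ≤ dist (q 0) (q 1) := dist_nonneg
  have n1 : 0 ≤ dist (q 1) (q 2) := dist_nonneg
  have n2 : 0 ≤ dist (q 2) (q 3) := dist_nonneg
  have n3 : 0 ≤ dist (q 3) (q 4) := dist_nonneg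
  have n4 : 0 ≤ dist (q 4) (q 0) := dist_nonneg
  have t3 := dist_triangle (q 3) (q 4) (q 0)
  have t2 := dist_triangle (q 2) (q 3) (q 0)
  have t1 := dist_comm (q 0) (q 1)
  simp only [closedLength, Fin.sum_univ_five, Fin.isValue, Fin.reduceAdd, zero_add]
  fin_cases k <;> simp <;> linarith

theorem signedArea_sub_const (q : Fin 5 → ℂ) (v : ℂ) :
    signedArea (fun k => q k - v) = signedArea q := by
  simp only [signedArea, Fin.sum_univ_five, Fin.isValue, Fin.reduceAdd, zero_add, planeCross,
    Complex.sub_re, Complex.sub_im]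
  ring

/-- Among the closed pentagonal paths of bounded length and area bounded below, one minimizing
the sum of the squared side lengths exists. -/
theorem exists_min_sumSqSides (p : Fin 5 → ℂ) : ∃ q : Fin 5 → ℂ,
    closedLength q ≤ closedLength p ∧ signedArea p ≤ signedArea q ∧
    ∀ r, closedLength r ≤ closedLength q → signedArea q ≤ signedArea r →
      sumSqSides q ≤ sumSqSides r := by
  -- Pinning `q 0` at the origin removes translations; the length bound then makes the set bounded,
  -- hence compact.
  set K : Set (Fin 5 → ℂ) := {q | q 0 = 0 ∧ closedLength q ≤ closedLength p ∧
    signedArea p ≤ signedArea q} with hK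
  have cL : Continuous closedLength := by unfold closedLength; fun_prop
  have cA : Continuous signedArea := by unfold signedArea planeCross; fun_prop
  have cS : Continuous sumSqSides := by unfold sumSqSides; fun_prop
  have hcl : IsClosed K := by
    refine (isClosed_eq (by fun_prop) (by fun_prop)).inter ?_
    exact (isClosed_le cL continuous_const).inter (isClosed_le continuous_const cA)
  have hbd : K ⊆ Metric.closedBall 0 (closedLength p) := by
    rintro q ⟨h0, h1, -⟩
    have hp : 0 ≤ closedLength p :=
      (Finset.sum_nonneg fun _ _ => dist_nonneg).trans h1
    rw [Metric.mem_closedBall, dist_pi_le_iff hp]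
    intro k
    have := dist_le_closedLength q k
    rw [h0] at this
    exact this.trans h1
  have trans_mem : ∀ r, closedLength r ≤ closedLength p → signedArea p ≤ signedArea r →
      (fun k => r k - r 0) ∈ K := by
    intro r h1 h2
    refine ⟨sub_self _, ?_, by rwa [signedArea_sub_const]⟩
    simpa [closedLength] using h1
  obtain ⟨q, hq, hmin⟩ := ((isCompact_closedBall _ _).of_isClosed_subset hcl hbd).exists_isMinOn
    ⟨_, trans_mem p le_rfl le_rfl⟩ cS.continuousOn
  refine ⟨q, hq.2.1, hq.2.2, fun r h1 h2 => ?_⟩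
  have := hmin (trans_mem r (h1.trans hq.2.1) (hq.2.2.trans h2))
  simpa [sumSqSides] using this

theorem sum_rotate (f : Fin 5 → ℝ) (j : Fin 5) : ∑ k, f (k + j) = ∑ k, f k :=
  Equiv.sum_comp (Equiv.addRight j) f

/-- Making two adjacent sides equal decreases the sum of squared side lengths. -/
theorem exists_sumSqSides_lt {q : Fin 5 → ℂ} {j : Fin 5}
    (h : dist (q j) (q (j + 1)) ≠ dist (q (j + 1)) (q (j + 2))) :
    ∃ r : Fin 5 → ℂ, closedLength r ≤ closedLength q ∧ signedArea q ≤ signedArea r ∧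
      sumSqSides r < sumSqSides q := by
  have rot (k : Fin 5) : k + 1 + j = k + j + 1 := add_right_comm _ _ _
  have eL : closedLength q = closedLength fun k => q (k + j) := by
    simp only [closedLength, rot]; exact (sum_rotate (fun k => dist (q k) (q (k + 1))) j).symm
  have eS : sumSqSides q = sumSqSides fun k => q (k + j) := by
    simp only [sumSqSides, rot]; exact (sum_rotate (fun k => dist (q k) (q (k + 1)) ^ 2) j).symm
  have eA : signedArea q = signedArea fun k => q (k + j) := by
    simp only [signedArea, rot]
    rw [← sum_rotate (fun k => planeCross (q k) (q (k + 1))) j]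
  rw [eL, eS, eA]
  replace h : dist (q (0 + j)) (q (1 + j)) ≠ dist (q (1 + j)) (q (2 + j)) := by
    rwa [zero_add, add_comm 1, add_comm 2]
  set p : Fin 5 → ℂ := fun k => q (k + j)
  change dist (p 0) (p 1) ≠ dist (p 1) (p 2) at h
  clear_value p
  obtain ⟨b, h1, h2, h3⟩ := exists_isosceles (p 0) (p 1) (p 2)
  refine ⟨![p 0, b, p 2, p 3, p 4], ?_, ?_, ?_⟩
  · simp only [closedLength, Fin.sum_univ_five, Fin.isValue, Fin.reduceAdd, zero_add,
      Matrix.cons_val]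
    linarith
  · simp only [signedArea, Fin.sum_univ_five, Fin.isValue, Fin.reduceAdd, zero_add,
      Matrix.cons_val]
    linarith
  · simp only [sumSqSides, Fin.sum_univ_five, Fin.isValue, Fin.reduceAdd, zero_add,
      Matrix.cons_val]
    rw [h1, h2]
    nlinarith [sq_pos_of_ne_zero (sub_ne_zero.2 h)]

/-- The isoperimetric inequality for closed pentagonal paths. -/
theorem signedArea_le_closedLength_sq (p : Fin 5 → ℂ) :
    20 * √(5 - 2 * √5) * signedArea p ≤ closedLength p ^ 2 := by
  obtain ⟨q, h1, h2, hmin⟩ := exists_min_sumSqSides p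
  -- Equalizing two unequal adjacent sides would keep both constraints and lower the minimum, so the
  -- minimizer is equilateral. Then Cauchy-Schwarz between length and squared sides is an equality,
  -- and the Wirtinger bound applies.
  have adj : ∀ j, dist (q j) (q (j + 1)) = dist (q (j + 1)) (q (j + 2)) := by
    intro j
    by_contra h
    obtain ⟨r, r1, r2, r3⟩ := exists_sumSqSides_lt h
    exact (hmin r r1 r2).not_gt r3
  have a0 := adj 0
  have a1 := adj 1
  have a2 := adj 2
  have a3 := adj 3
  have hW := signedArea_le_sumSqSides q
  have hn : 0 ≤ closedLength q := Finset.sum_nonneg fun _ _ => dist_nonneg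
  have hS : closedLength q ^ 2 = 5 * sumSqSides q := by
    simp only [Fin.isValue, Fin.reduceAdd, zero_add] at a0 a1 a2 a3
    simp only [closedLength, sumSqSides, Fin.sum_univ_five, Fin.isValue, Fin.reduceAdd, zero_add]
    rw [← a3, ← a2, ← a1, ← a0]; ring
  have ht : 0 ≤ √(5 - 2 * √5) := Real.sqrt_nonneg _
  calc _ ≤ 20 * √(5 - 2 * √5) * signedArea q := by gcongr
    _ ≤ closedLength q ^ 2 := by rw [hS]; linarith
    _ ≤ _ := by gcongr

/-! ### The isoperimetric inequality for hulls of four points. -/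

/-- If the segments `[a, c]` and `[b, d]` meet, the hull of their endpoints is the union of the
triangles on both sides of `[a, c]`. -/
theorem convexHull_subset_of_segments_meet {a b c d o : ℂ} (h1 : o ∈ segment ℝ a c)
    (h2 : o ∈ segment ℝ b d) :
    convexHull ℝ {a, b, c, d} ⊆ convexHull ℝ {a, b, c} ∪ convexHull ℝ {c, d, a} := by
  intro x hx
  have e : ({a, b, c, d} : Set ℂ) = {a, c} ∪ {b, d} := by ext; simp; tauto
  rw [e, convexHull_union (by simp) (by simp), convexHull_pair, convexHull_pair,
    mem_convexJoin] at hx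
  obtain ⟨y, hy, w, hw, hx⟩ := hx
  -- The crossing point `o` cuts `[b, d]` into two pieces, one in each triangle.
  have split : w ∈ segment ℝ b o ∨ w ∈ segment ℝ d o := by
    rw [segment_eq_image_lineMap] at h2 hw
    obtain ⟨t, ⟨t0, t1⟩, rfl⟩ := h2
    obtain ⟨s, ⟨s0, s1⟩, rfl⟩ := hw
    rcases le_total s t with h | h
    · left
      rcases t0.eq_or_lt with rfl | t0
      · obtain rfl : s = 0 := le_antisymm h s0
        simp
      · rw [segment_eq_image_lineMap]
        refine ⟨s / t, ⟨by positivity, by rw [div_le_one t0]; exact h⟩, ?_⟩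
        rw [AffineMap.lineMap_lineMap_right, div_mul_cancel₀ _ t0.ne']
    · right
      rcases t1.eq_or_lt with rfl | t1
      · obtain rfl : s = 1 := le_antisymm s1 h
        simp
      · rw [segment_eq_image_lineMap]
        have t1' : 1 - t ≠ 0 := by linarith
        refine ⟨(1 - s) / (1 - t), ⟨by apply div_nonneg <;> linarith,
          by rw [div_le_one (by linarith)]; linarith⟩, ?_⟩
        simp only [AffineMap.lineMap_apply, vsub_eq_sub, vadd_eq_add, Complex.real_smul]
        push_cast
        have : (1 - (t : ℂ)) ≠ 0 := by exact_mod_cast t1'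
        field_simp
        ring
  rcases split with h | h
  · left
    have hC := convex_convexHull ℝ ({a, b, c} : Set ℂ)
    have hm : ∀ y ∈ ({a, b, c} : Set ℂ), y ∈ convexHull ℝ {a, b, c} := subset_convexHull ℝ _
    have hac := hC.segment_subset (hm a (by simp)) (hm c (by simp))
    exact hC.segment_subset (hac hy)
      (hC.segment_subset (hm b (by simp)) (hac h1) h) hx
  · right
    have hC := convex_convexHull ℝ ({c, d, a} : Set ℂ)
    have hm : ∀ y ∈ ({c, d, a} : Set ℂ), y ∈ convexHull ℝ {c, d, a} := subset_convexHull ℝ _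
    have hac := hC.segment_subset (hm a (by simp)) (hm c (by simp))
    exact hC.segment_subset (hac hy)
      (hC.segment_subset (hm d (by simp)) (hac h1) h) hx

/-- Either diagonal cuts the hull into two triangles, each of area at most half a product of
adjacent sides. The smaller of the two bounds is at most their mean `(ab + cd)(bc + da) / 4`, and
the inequality of arithmetic and geometric means finishes. -/
theorem volume_convexHull_le_of_segments_meet {a b c d o : ℂ} (h1 : o ∈ segment ℝ a c)
    (h2 : o ∈ segment ℝ b d) :
    volume (convexHull ℝ {a, b, c, d}) ≤
      ENNReal.ofReal ((dist a b + dist b c + dist c d + dist d a) ^ 2 / 16) := by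
  have v1 : volume (convexHull ℝ {a, b, c, d}) ≤
      ENNReal.ofReal ((dist a b * dist b c + dist c d * dist d a) / 2) := by
    refine (measure_mono (convexHull_subset_of_segments_meet h1 h2)).trans <|
      (measure_union_le _ _).trans ?_
    rw [add_div, ENNReal.ofReal_add (by positivity) (by positivity)]
    exact add_le_add (volume_triangle_le_dist_mul_dist _ _ _)
      (volume_triangle_le_dist_mul_dist _ _ _)
  have v2 : volume (convexHull ℝ {a, b, c, d}) ≤
      ENNReal.ofReal ((dist b c * dist c d + dist d a * dist a b) / 2) := by
    have e : ({a, b, c, d} : Set ℂ) = {b, c, d, a} := by ext; simp; tauto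
    rw [e]
    refine (measure_mono (convexHull_subset_of_segments_meet h2
      (segment_symm ℝ a c ▸ h1))).trans <| (measure_union_le _ _).trans ?_
    rw [add_div, ENNReal.ofReal_add (by positivity) (by positivity)]
    exact add_le_add (volume_triangle_le_dist_mul_dist _ _ _)
      (volume_triangle_le_dist_mul_dist _ _ _)
  have key := sq_nonneg (dist a b + dist c d - (dist b c + dist d a))
  rcases le_total (dist a b * dist b c + dist c d * dist d a)
    (dist b c * dist c d + dist d a * dist a b) with h | h
  · exact v1.trans (ENNReal.ofReal_le_ofReal (by nlinarith))
  · exact v2.trans (ENNReal.ofReal_le_ofReal (by nlinarith))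

/-- Triangle inequalities through the crossing point. This shows that uncrossing a self-intersecting
quadrilateral path does not lengthen it. -/
theorem dist_add_dist_le_of_segments_meet {a b c d o : ℂ} (h1 : o ∈ segment ℝ a c)
    (h2 : o ∈ segment ℝ b d) : dist a b + dist c d ≤ dist a c + dist b d := by
  have e1 := dist_add_dist_of_mem_segment h1
  have e2 := dist_add_dist_of_mem_segment h2
  have t1 := dist_triangle a o b
  have t2 := dist_triangle c o d
  have := dist_comm b o
  have := dist_comm c o
  linarith

/-- The area is at most `bc · min(ab, ca) / 2`, hence at most `bc (ab + ca) / 4`, which is at most a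
sixteenth of the squared perimeter. This is crude for triangles but matches the quadrilateral bound.
-/
theorem volume_convexHull_le_of_mem {a b c d : ℂ} (h : d ∈ convexHull ℝ {a, b, c}) :
    volume (convexHull ℝ {a, b, c, d}) ≤
      ENNReal.ofReal ((dist a b + dist b c + dist c a) ^ 2 / 16) := by
  have hsub : convexHull ℝ {a, b, c, d} ⊆ convexHull ℝ {a, b, c} := by
    refine convexHull_min ?_ (convex_convexHull ℝ _)
    have hm : ∀ y ∈ ({a, b, c} : Set ℂ), y ∈ convexHull ℝ {a, b, c} := subset_convexHull ℝ _
    rintro y (rfl | rfl | rfl | rfl)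
    exacts [hm _ (by simp), hm _ (by simp), hm _ (by simp), h]
  have v1 := (measure_mono (μ := volume) hsub).trans (volume_triangle_le_dist_mul_dist a b c)
  have v2 := (measure_mono (μ := volume) hsub)
  have e : ({a, b, c} : Set ℂ) = {b, c, a} := by ext; simp; tauto
  rw [e] at v2
  replace v2 := v2.trans (volume_triangle_le_dist_mul_dist b c a)
  have key := sq_nonneg (dist a b + dist c a - dist b c)
  rcases le_total (dist a b) (dist c a) with h | h
  · exact v1.trans (ENNReal.ofReal_le_ofReal (by nlinarith [@dist_nonneg _ _ b c]))
  · exact v2.trans (ENNReal.ofReal_le_ofReal (by nlinarith [@dist_nonneg _ _ b c]))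

/-- Radon's theorem for four points in the plane. -/
theorem four_points_radon (a b c d : ℂ) :
    a ∈ convexHull ℝ {b, c, d} ∨ b ∈ convexHull ℝ {a, c, d} ∨ c ∈ convexHull ℝ {a, b, d} ∨
    d ∈ convexHull ℝ {a, b, c} ∨ (segment ℝ a b ∩ segment ℝ c d).Nonempty ∨
    (segment ℝ a c ∩ segment ℝ b d).Nonempty ∨ (segment ℝ a d ∩ segment ℝ b c).Nonempty := by
  have hna : ¬ AffineIndependent ℝ ![a, b, c, d] := by
    intro h
    have := h.card_le_finrank_succ
    have h2 := Submodule.finrank_le (vectorSpan ℝ (range ![a, b, c, d]))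
    rw [Complex.finrank_real_complex] at h2
    simp at this
    omega
  -- Swapping the two Radon classes puts point 0 in the first, leaving eight partitions.
  obtain ⟨I, hI⟩ : ∃ I : Set (Fin 4), 0 ∈ I ∧ (convexHull ℝ (![a, b, c, d] '' I) ∩
      convexHull ℝ (![a, b, c, d] '' Iᶜ)).Nonempty := by
    obtain ⟨I, hI⟩ := Convex.radon_partition hna
    by_cases h : (0 : Fin 4) ∈ I
    · exact ⟨I, h, hI⟩
    · exact ⟨Iᶜ, h, by rwa [compl_compl, inter_comm]⟩
  obtain ⟨h0, x, hx1, hx2⟩ := hI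
  have up : ∀ S T : Set ℂ, (∀ i, i ∈ I → ![a, b, c, d] i ∈ S) →
      (∀ i, i ∉ I → ![a, b, c, d] i ∈ T) → x ∈ convexHull ℝ S ∧ x ∈ convexHull ℝ T := by
    intro S T hS hT
    refine ⟨convexHull_mono ?_ hx1, convexHull_mono ?_ hx2⟩
    · rintro _ ⟨i, hi, rfl⟩; exact hS i hi
    · rintro _ ⟨i, hi, rfl⟩; exact hT i hi
  simp only [← convexHull_pair]
  by_cases h1 : (1 : Fin 4) ∈ I <;> by_cases h2 : (2 : Fin 4) ∈ I <;> by_cases h3 : (3 : Fin 4) ∈ I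
  · have := (up univ ∅ (by simp) (by simp [Fin.forall_fin_succ, h0, h1, h2, h3])).2
    simp at this
  · obtain ⟨p, q⟩ := up {a, b, c} {d} (by simp [Fin.forall_fin_succ, h0, h1, h2, h3])
      (by simp [Fin.forall_fin_succ, h0, h1, h2])
    simp only [convexHull_singleton, mem_singleton_iff] at q
    subst q; tauto
  · obtain ⟨p, q⟩ := up {a, b, d} {c} (by simp [Fin.forall_fin_succ, h0, h1, h2])
      (by simp [Fin.forall_fin_succ, h0, h1, h2, h3])
    simp only [convexHull_singleton, mem_singleton_iff] at q
    subst q; tauto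
  · obtain ⟨p, q⟩ := up {a, b} {c, d} (by simp [Fin.forall_fin_succ, h0, h1, h2, h3])
      (by simp [Fin.forall_fin_succ, h0, h1, h2])
    have : (convexHull ℝ {a, b} ∩ convexHull ℝ {c, d}).Nonempty := ⟨x, p, q⟩
    tauto
  · obtain ⟨p, q⟩ := up {a, c, d} {b} (by simp [Fin.forall_fin_succ, h0, h1, h2])
      (by simp [Fin.forall_fin_succ, h0, h1, h2, h3])
    simp only [convexHull_singleton, mem_singleton_iff] at q
    subst q; tauto
  · obtain ⟨p, q⟩ := up {a, c} {b, d} (by simp [Fin.forall_fin_succ, h0, h1, h2, h3])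
      (by simp [Fin.forall_fin_succ, h0, h1, h2])
    have : (convexHull ℝ {a, c} ∩ convexHull ℝ {b, d}).Nonempty := ⟨x, p, q⟩
    tauto
  · obtain ⟨p, q⟩ := up {a, d} {b, c} (by simp [Fin.forall_fin_succ, h0, h1, h2])
      (by simp [Fin.forall_fin_succ, h0, h1, h2, h3])
    have : (convexHull ℝ {a, d} ∩ convexHull ℝ {b, c}).Nonempty := ⟨x, p, q⟩
    tauto
  · obtain ⟨p, q⟩ := up {a} {b, c, d} (by simp [Fin.forall_fin_succ, h0, h1, h2, h3])
      (by simp [Fin.forall_fin_succ, h0, h1, h2])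
    simp only [convexHull_singleton, mem_singleton_iff] at p
    subst p; tauto

/-- The isoperimetric inequality for the convex hull of a closed quadrilateral path. -/
theorem volume_convexHull_four_le (a b c d : ℂ) :
    volume (convexHull ℝ {a, b, c, d}) ≤
      ENNReal.ofReal ((dist a b + dist b c + dist c d + dist d a) ^ 2 / 16) := by
  have mono : ∀ {S T : Set ℂ} {x y : ℝ}, S = T → volume (convexHull ℝ T) ≤
      ENNReal.ofReal (x ^ 2 / 16) → 0 ≤ x → x ≤ y →
      volume (convexHull ℝ S) ≤ ENNReal.ofReal (y ^ 2 / 16) := by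
    rintro S T x y rfl h h0 hxy
    exact h.trans (ENNReal.ofReal_le_ofReal (by gcongr))
  have c1 := dist_comm a b
  have c2 := dist_comm a c
  have c3 := dist_comm a d
  have c4 := dist_comm b c
  have c5 := dist_comm b d
  have c6 := dist_comm c d
  rcases four_points_radon a b c d with h | h | h | h | ⟨o, h1, h2⟩ | ⟨o, h1, h2⟩ | ⟨o, h1, h2⟩
  · refine mono (by ext; simp; tauto) (volume_convexHull_le_of_mem h) (by positivity) ?_
    linarith [dist_triangle d a b]
  · refine mono (by ext; simp; tauto) (volume_convexHull_le_of_mem h) (by positivity) ?_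
    linarith [dist_triangle a b c]
  · refine mono (by ext; simp; tauto) (volume_convexHull_le_of_mem h) (by positivity) ?_
    linarith [dist_triangle b c d]
  · refine mono rfl (volume_convexHull_le_of_mem h) (by positivity) ?_
    linarith [dist_triangle c d a]
  -- Here two opposite sides of the path cross; the bound is applied to the uncrossed ordering of
  -- the four points, which is no longer.
  · refine mono (by ext; simp; tauto) (volume_convexHull_le_of_segments_meet h1 h2)
      (by positivity) ?_
    linarith [dist_add_dist_le_of_segments_meet h1 h2]
  · exact volume_convexHull_le_of_segments_meet h1 h2
  · refine mono (by ext; simp; tauto) (volume_convexHull_le_of_segments_meet h1 h2)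
      (by positivity) ?_
    linarith [dist_add_dist_le_of_segments_meet h1 (segment_symm ℝ b c ▸ h2)]

/-! ### Pentagonal regions, their hulls and reflex vertices. -/

theorem Polygon.pentagonPerimeter_eq (p : Polygon ℂ 5) :
    p.pentagonPerimeter = closedLength p.vertices := by
  simp [Polygon.pentagonPerimeter, closedLength]

theorem Polygon.edgeSet_eq_segment (p : Polygon ℂ 5) (k : Fin 5) :
    p.edgeSet ℝ k = segment ℝ (p k) (p (k + 1)) := by
  rw [Polygon.edgeSet, affineSegment_eq_segment, finRotate_apply]

theorem Polygon.mem_edgeSet (p : Polygon ℂ 5) (k : Fin 5) {s : ℝ} (h0 : 0 ≤ s) (h1 : s ≤ 1) :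
    p k + s * (p (k + 1) - p k) ∈ p.edgeSet ℝ k := by
  rw [Polygon.edgeSet_eq_segment, segment_eq_image']
  exact ⟨s, ⟨h0, h1⟩, by simp⟩

theorem Polygon.boundary_subset_convexHull (p : Polygon ℂ 5) :
    p.boundary ℝ ⊆ convexHull ℝ (range p.vertices) := by
  refine iUnion_subset fun k => ?_
  rw [Polygon.edgeSet_eq_segment]
  exact segment_subset_convexHull (mem_range_self _) (mem_range_self _)

namespace Pentagon

theorem isClosed_carrier (P : Pentagon) : IsClosed P.carrier := P.isCompact.isClosed

theorem edgeSet_subset_frontier (P : Pentagon) (k : Fin 5) :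
    P.poly.edgeSet ℝ k ⊆ frontier P.carrier := by
  rw [P.frontier_eq]; exact subset_iUnion (fun k => P.poly.edgeSet ℝ k) k

theorem edgeSet_subset_carrier (P : Pentagon) (k : Fin 5) :
    P.poly.edgeSet ℝ k ⊆ P.carrier :=
  (P.edgeSet_subset_frontier k).trans P.isClosed_carrier.frontier_subset

/-- A functional separating a point of the region from the hull attains its maximum on the compact
region. An interior maximum forces the functional to vanish, and a frontier maximum lies on the
path, hence in the hull. The Jordan curve theorem is not needed. -/
theorem carrier_subset_convexHull (P : Pentagon) :
    P.carrier ⊆ convexHull ℝ (range P.poly.vertices) := by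
  intro x hx
  by_contra hxK
  obtain ⟨f, u, hf, hu⟩ := geometric_hahn_banach_closed_point (convex_convexHull ℝ _)
    ((Set.finite_range P.poly.vertices).isClosed_convexHull ℝ) hxK
  obtain ⟨y, hy, hmax⟩ := P.isCompact.exists_isMaxOn ⟨x, hx⟩ f.continuous.continuousOn
  have hxy : f x ≤ f y := hmax hx
  by_cases hyi : y ∈ interior P.carrier
  · have h0 := (hmax.isLocalMax (mem_interior_iff_mem_nhds.1 hyi)).fderiv_eq_zero
    rw [ContinuousLinearMap.fderiv] at h0
    have hv := hf _ (subset_convexHull ℝ _ (mem_range_self 0))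
    simp only [h0, zero_apply] at hv hu
    linarith
  · have hyf : y ∈ frontier P.carrier := ⟨subset_closure hy, hyi⟩
    rw [P.frontier_eq] at hyf
    have := hf y (P.poly.boundary_subset_convexHull hyf)
    linarith

/-- A vertex with reflex angle lies in the convex hull of the other vertices. -/
theorem reflex_mem_convexHull (P : Pentagon) {k : Fin 5} {θ : ℝ}
    (h : HasInteriorAngle P.carrier (P.poly k) θ) (hθ : Real.pi < θ) :
    P.poly k ∈ convexHull ℝ (P.poly.vertices '' {k}ᶜ) := by
  by_contra hk
  obtain ⟨f, w, hf, hw⟩ := geometric_hahn_banach_closed_point (convex_convexHull ℝ _)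
    (((Set.toFinite {k}ᶜ).image P.poly.vertices).isClosed_convexHull ℝ) hk
  -- The separating functional is maximal over the whole region at the reflex vertex, so it is
  -- nonpositive on every direction of the sector.
  have hle : ∀ x ∈ P.carrier, f x ≤ f (P.poly k) := by
    intro x hx
    refine convexHull_min (s := range P.poly.vertices) (t := {x | f x ≤ f (P.poly k)}) ?_
      (convex_halfSpace_le f.isLinear _) (P.carrier_subset_convexHull hx)
    rintro _ ⟨j, rfl⟩
    by_cases hj : j = k
    · subst hj; exact (le_refl (f (P.poly j)))
    · exact ((hf _ (subset_convexHull ℝ _ ⟨j, hj, rfl⟩)).trans hw).le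
  obtain ⟨-, h2π, u, hu, ε, hε, hS⟩ := h
  have hpi := Real.pi_pos
  have g : ∀ φ : ℝ, 0 ≤ φ → φ ≤ θ → f (u * Complex.exp (φ * Complex.I)) ≤ 0 := by
    intro φ h0 h1
    have := hle _ ((hS (ε / 2) φ (by positivity) (by linarith) h0 (by linarith)).2 h1)
    rw [mul_assoc, map_add, ← Complex.real_smul, map_smul, smul_eq_mul] at this
    by_contra! hc
    nlinarith [mul_pos (half_pos hε) hc]
  have expand : ∀ φ : ℝ, f (u * Complex.exp (φ * Complex.I)) =
      Real.cos φ * f u + Real.sin φ * f (u * Complex.I) := by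
    intro φ
    rw [Complex.exp_mul_I, ← Complex.ofReal_cos, ← Complex.ofReal_sin]
    have : u * ((Real.cos φ : ℂ) + (Real.sin φ : ℂ) * Complex.I) =
        Real.cos φ • u + Real.sin φ • (u * Complex.I) := by
      simp only [Complex.real_smul]; ring
    rw [this, map_add, map_smul, map_smul, smul_eq_mul, smul_eq_mul]
  simp only [expand] at g
  -- A sector wider than `π` contains two independent pairs of opposite directions, at angles `0`
  -- and `π` and at `(θ - π) / 2` and its opposite. So `f` vanishes, against strict separation.
  have g0 := g 0 le_rfl (by linarith)
  have g1 := g Real.pi hpi.le hθ.le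
  simp at g0 g1
  have fu : f u = 0 := le_antisymm g0 g1
  have g2 := g ((θ - Real.pi) / 2) (by linarith) (by linarith)
  have g3 := g ((θ - Real.pi) / 2 + Real.pi) (by linarith) (by linarith)
  rw [fu, Real.sin_add_pi] at g3
  rw [fu] at g2
  have hs : 0 < Real.sin ((θ - Real.pi) / 2) := Real.sin_pos_of_pos_of_lt_pi (by linarith)
    (by linarith)
  have fi : f (u * Complex.I) = 0 := by
    apply le_antisymm <;> nlinarith
  have hu0 : u ≠ 0 := by rintro rfl; simp at hu
  have f0 : ∀ z, f z = 0 := by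
    intro z
    have : z = (z / u).re • u + (z / u).im • (u * Complex.I) := by
      simp only [Complex.real_smul]
      calc z = u * (z / u) := by field_simp
        _ = u * ((z / u).re + (z / u).im * Complex.I) := by rw [Complex.re_add_im]
        _ = _ := by ring
    rw [this, map_add, map_smul, map_smul, fu, fi]; simp
  have := hf (P.poly (k + 1)) (subset_convexHull ℝ _ ⟨k + 1, by simp, rfl⟩)
  rw [f0] at this hw
  linarith

/-- A nonconvex pentagon of area at least `1` has perimeter at least that of the unit square. -/
theorem four_le_perimeter_of_isNonconvex (P : Pentagon) (hv : 1 ≤ volume P.carrier)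
    (h : P.IsNonconvex) : 4 ≤ P.poly.pentagonPerimeter := by
  obtain ⟨k, θ, hk, hθ⟩ := h
  have hmem := P.reflex_mem_convexHull hk hθ
  set q := P.poly.vertices with hq
  have himg : q '' {k}ᶜ = {q (k + 1), q (k + 2), q (k + 3), q (k + 4)} := by
    have : ({k}ᶜ : Set (Fin 5)) = {k + 1, k + 2, k + 3, k + 4} := by
      ext j
      simp only [mem_compl_iff, mem_singleton_iff, mem_insert_iff]
      clear hk hmem
      revert j k; decide
    rw [this]; simp [image_insert_eq]
  have hsub : convexHull ℝ (range q) ⊆ convexHull ℝ (q '' {k}ᶜ) := by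
    refine convexHull_min ?_ (convex_convexHull ℝ _)
    rintro _ ⟨j, rfl⟩
    by_cases hj : j = k
    · subst hj; exact hmem
    · exact subset_convexHull ℝ _ ⟨j, hj, rfl⟩
  rw [himg] at hsub
  have h1 := hv.trans <| (measure_mono (P.carrier_subset_convexHull.trans hsub)).trans
    (volume_convexHull_four_le _ _ _ _)
  rw [ENNReal.one_le_ofReal] at h1
  have hL : closedLength q = dist (q k) (q (k + 1)) + dist (q (k + 1)) (q (k + 2)) +
      dist (q (k + 2)) (q (k + 3)) + dist (q (k + 3)) (q (k + 4)) + dist (q (k + 4)) (q k) := by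
    rw [closedLength, ← sum_rotate _ k, Fin.sum_univ_five]
    have e : ∀ i : Fin 5, i + k = k + i := fun i => add_comm _ _
    simp [e, add_assoc]
  rw [Polygon.pentagonPerimeter_eq, hL]
  set L := dist (q (k + 1)) (q (k + 2)) + dist (q (k + 2)) (q (k + 3)) +
    dist (q (k + 3)) (q (k + 4)) + dist (q (k + 4)) (q (k + 1)) with hL'
  have hL0 : 0 ≤ L := by positivity
  -- Dropping the reflex vertex replaces two sides by the diagonal joining its neighbours, so `L` is
  -- at most the perimeter.
  have : 4 ≤ L := by nlinarith
  have := dist_triangle (q (k + 4)) (q k) (q (k + 1))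
  linarith

end Pentagon

/-! ### Sectors at vertices, turning angles and convex tiles. -/

/-- Polar coordinates with respect to a unit direction. -/
theorem exists_polar {u : ℂ} (hu : ‖u‖ = 1) (w : ℂ) : ∃ φ : ℝ, 0 ≤ φ ∧ φ < 2 * Real.pi ∧
    w = ‖w‖ * u * Complex.exp (φ * Complex.I) := by
  have hu0 : u ≠ 0 := by rintro rfl; simp at hu
  have h : w = ‖w‖ * u * Complex.exp ((w / u).arg * Complex.I) := by
    have := Complex.norm_mul_exp_arg_mul_I (w / u)
    rw [norm_div, hu, div_one] at this
    rw [mul_right_comm, this]; field_simp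
  have h1 := Complex.neg_pi_lt_arg (w / u)
  have h2 := Complex.arg_le_pi (w / u)
  have hpi := Real.pi_pos
  rcases le_or_gt 0 (w / u).arg with h0 | h0
  · exact ⟨_, h0, by linarith, h⟩
  · refine ⟨(w / u).arg + 2 * Real.pi, by linarith, by linarith, ?_⟩
    rw [Complex.ofReal_add, add_mul, Complex.ofReal_mul, Complex.ofReal_ofNat,
      Complex.exp_periodic]
    exact h

/-- The open sector at a vertex belongs to the interior of the region. -/
theorem mem_interior_of_mem_sector {S : Set ℂ} {v u : ℂ} {θ ε : ℝ} (hu : ‖u‖ = 1)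
    (hS : ∀ r φ : ℝ, 0 < r → r < ε → 0 ≤ φ → φ < 2 * Real.pi →
      (v + r * u * Complex.exp (φ * Complex.I) ∈ S ↔ φ ≤ θ)) (hθ : θ < 2 * Real.pi)
    {r φ : ℝ} (hr : 0 < r) (hrε : r < ε) (h0 : 0 < φ) (h1 : φ < θ) :
    v + r * u * Complex.exp (φ * Complex.I) ∈ interior S := by
  set d := u * Complex.exp (φ * Complex.I) with hd
  have hdn : ‖d‖ = 1 := by rw [hd, norm_mul, hu, Complex.norm_exp_ofReal_mul_I, one_mul]
  have hd0 : d ≠ 0 := by intro h; simp [h] at hdn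
  have hx : v + r * u * Complex.exp (φ * Complex.I) = v + r * d := by rw [hd]; ring
  rw [hx, mem_interior_iff_mem_nhds]
  have hq : ((v + r * d) - v) / d = r := by field_simp; ring
  have c1 : ContinuousAt (fun x : ℂ => (x - v) / d) (v + r * d) := by fun_prop
  have c2 : ContinuousAt (fun x : ℂ => ((x - v) / d).arg) (v + r * d) := by
    refine ContinuousAt.comp (g := Complex.arg) (Complex.continuousAt_arg ?_) c1
    rw [hq]; exact Complex.ofReal_mem_slitPlane.2 hr
  have c3 : ContinuousAt (fun x : ℂ => ‖(x - v) / d‖) (v + r * d) := c1.norm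
  have e2 : (((v + r * d) - v) / d).arg = 0 := by rw [hq]; exact Complex.arg_ofReal_of_nonneg hr.le
  have e3 : ‖((v + r * d) - v) / d‖ = r := by rw [hq]; simp [hr.le]
  have n2 := c2.eventually (Ioo_mem_nhds (a := -φ) (b := θ - φ) (by simp only [e2]; linarith)
    (by simp only [e2]; linarith))
  have n3 := c3.eventually (Ioo_mem_nhds (a := 0) (b := ε) (by simp only [e3]; linarith)
    (by simp only [e3]; linarith))
  filter_upwards [n2, n3] with x hx2 hx3
  have := (hS ‖(x - v) / d‖ (φ + ((x - v) / d).arg) hx3.1 hx3.2 (by linarith [hx2.1])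
    (by linarith [hx2.2])).2 (by linarith [hx2.2])
  convert this using 1
  rw [Complex.ofReal_add, add_mul, Complex.exp_add]
  calc x = v + ((x - v) / d) * d := by field_simp; ring
    _ = v + (‖(x - v) / d‖ * Complex.exp (((x - v) / d).arg * Complex.I)) * d := by
        rw [Complex.norm_mul_exp_arg_mul_I]
    _ = _ := by rw [hd]; ring

/-- A segment of the frontier that starts at a vertex runs along a side of the sector. -/
theorem direction_of_frontier {S : Set ℂ} (hcl : IsClosed S) {v u a : ℂ} {θ ε : ℝ} (hu : ‖u‖ = 1)
    (hε : 0 < ε) (hθ : θ < 2 * Real.pi)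
    (hS : ∀ r φ : ℝ, 0 < r → r < ε → 0 ≤ φ → φ < 2 * Real.pi →
      (v + r * u * Complex.exp (φ * Complex.I) ∈ S ↔ φ ≤ θ)) (ha0 : a ≠ 0)
    (ha : ∀ s : ℝ, 0 ≤ s → s ≤ 1 → v + s * a ∈ frontier S) :
    a = ‖a‖ * u ∨ a = ‖a‖ * u * Complex.exp (θ * Complex.I) := by
  obtain ⟨φ, h0, h1, h⟩ := exists_polar hu a
  have hn : 0 < ‖a‖ := norm_pos_iff.2 ha0
  obtain ⟨r, hr0, hr⟩ : ∃ r, 0 < r ∧ r < min ε ‖a‖ := exists_between (lt_min hε hn)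
  have hz : v + r * u * Complex.exp (φ * Complex.I) ∈ frontier S := by
    have := ha (r / ‖a‖) (by positivity)
      ((div_le_one hn).2 (hr.le.trans (min_le_right _ _)))
    convert this using 2
    rw [h]
    have : (‖a‖ : ℂ) ≠ 0 := by exact_mod_cast hn.ne'
    rw [← h]
    push_cast
    nth_rw 2 [h]
    field_simp
  have hrε : r < ε := hr.trans_le (min_le_left _ _)
  have hle := (hS r φ hr0 hrε h0 h1).1 (hcl.frontier_subset hz)
  rcases h0.eq_or_lt with rfl | h0
  · left; simpa using h
  rcases hle.eq_or_lt with rfl | hlt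
  · right; exact h
  · exact absurd (mem_interior_of_mem_sector hu hS hθ hr0 hrε h0 hlt) hz.2

namespace Pentagon

theorem vertex_ne (P : Pentagon) {j k : Fin 5} (h : j ≠ k) : P.poly j ≠ P.poly k :=
  fun e => h (P.isSimple.1 e)

theorem eq_vertex_of_mem_edgeSets (P : Pentagon) {k : Fin 5} {z : ℂ}
    (h1 : z ∈ P.poly.edgeSet ℝ k) (h2 : z ∈ P.poly.edgeSet ℝ (k + 1)) : z = P.poly (k + 1) := by
  rcases P.isSimple.2 k (k + 1) (by clear * -; revert k; decide) z ⟨h1, h2⟩ with h | h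
  · exact h.2
  · have := h.1
    rw [finRotate_apply] at this
    exact absurd this (by clear * -; revert k; decide)

/-- The turning of the boundary path at a vertex with convex interior angle `θ` is `±(π - θ)`. -/
theorem exists_turning (P : Pentagon) {k : Fin 5} {θ : ℝ}
    (h : HasInteriorAngle P.carrier (P.poly (k + 1)) θ) :
    ∃ ρ τ : ℝ, 0 < ρ ∧ (τ = Real.pi - θ ∨ τ = -(Real.pi - θ)) ∧
      P.poly (k + 2) - P.poly (k + 1) =
        (P.poly (k + 1) - P.poly k) * (ρ * Complex.exp (τ * Complex.I)) := by
  obtain ⟨-, hθ, u, hu, ε, hε, hS⟩ := h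
  set v := P.poly (k + 1) with hv
  obtain ⟨a, ha⟩ : ∃ a, a = P.poly (k + 2) - v := ⟨_, rfl⟩
  obtain ⟨b, hb⟩ : ∃ b, b = P.poly k - v := ⟨_, rfl⟩
  have ha0 : a ≠ 0 := by rw [ha]; exact sub_ne_zero.2 (P.vertex_ne (by clear * -; revert k; decide))
  have hb0 : b ≠ 0 := by rw [hb]; exact sub_ne_zero.2 (P.vertex_ne (by clear * -; revert k; decide))
  have e2 : k + 1 + 1 = k + 2 := by rw [add_assoc]; rfl
  have hae : ∀ s : ℝ, 0 ≤ s → s ≤ 1 → v + s * a ∈ P.poly.edgeSet ℝ (k + 1) := by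
    intro s h0 h1
    have := P.poly.mem_edgeSet (k + 1) h0 h1
    rwa [e2, ← hv, ← ha] at this
  have hbe : ∀ s : ℝ, 0 ≤ s → s ≤ 1 → v + s * b ∈ P.poly.edgeSet ℝ k := by
    intro s h0 h1
    have := P.poly.mem_edgeSet k (s := 1 - s) (by linarith) (by linarith)
    convert this using 1
    rw [hb, ← hv]; push_cast; ring
  have da := direction_of_frontier P.isClosed_carrier hu hε hθ hS ha0
    fun s h0 h1 => P.edgeSet_subset_frontier _ (hae s h0 h1)
  have db := direction_of_frontier P.isClosed_carrier hu hε hθ hS hb0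
    fun s h0 h1 => P.edgeSet_subset_frontier _ (hbe s h0 h1)
  have na : 0 < ‖a‖ := norm_pos_iff.2 ha0
  have nb : 0 < ‖b‖ := norm_pos_iff.2 hb0
  have nac : (‖a‖ : ℂ) ≠ 0 := by exact_mod_cast na.ne'
  have nbc : (‖b‖ : ℂ) ≠ 0 := by exact_mod_cast nb.ne'
  have hu0 : u ≠ 0 := by rintro rfl; simp at hu
  -- Two sides leaving the vertex in the same direction would overlap, contrary to simplicity of the
  -- path.
  have hne : ∀ d : ℂ, ¬ (a = ‖a‖ * d ∧ b = ‖b‖ * d) := by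
    rintro d ⟨h1, h2⟩
    have m1 : min ‖a‖ ‖b‖ / ‖a‖ ≤ 1 := (div_le_one na).2 (min_le_left _ _)
    have m2 : min ‖a‖ ‖b‖ / ‖b‖ ≤ 1 := (div_le_one nb).2 (min_le_right _ _)
    have m0 : 0 < min ‖a‖ ‖b‖ := lt_min na nb
    have p1 := hae _ (by positivity) m1
    have p2 := hbe _ (by positivity) m2
    have q1 : v + ((min ‖a‖ ‖b‖ / ‖a‖ : ℝ) : ℂ) * a = v + (min ‖a‖ ‖b‖ : ℝ) * d := by
      nth_rw 3 [h1]; push_cast; field_simp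
    have q2 : v + ((min ‖a‖ ‖b‖ / ‖b‖ : ℝ) : ℂ) * b = v + (min ‖a‖ ‖b‖ : ℝ) * d := by
      nth_rw 3 [h2]; push_cast; field_simp
    rw [q1] at p1
    rw [q2] at p2
    have := P.eq_vertex_of_mem_edgeSets p2 p1
    rw [← hv, add_eq_left, mul_eq_zero] at this
    rcases this with h | h
    · exact m0.ne' (by exact_mod_cast h)
    · rw [h, mul_zero] at h1; exact ha0 h1
  have hpi : Complex.exp ((Real.pi : ℂ) * Complex.I) = -1 := Complex.exp_pi_mul_I
  have hab : P.poly (k + 1) - P.poly k = -b := by rw [hb, ← hv]; ring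
  rw [← hv] at hab
  rw [← ha, hab]
  -- The outgoing side and the reversed incoming side occupy the two edges of the sector in one
  -- order or the other; the order is the orientation of the path and fixes the sign of the turn.
  rcases da with da | da <;> rcases db with db | db
  · exact absurd ⟨da, db⟩ (hne u)
  · refine ⟨‖a‖ / ‖b‖, Real.pi - θ, by positivity, Or.inl rfl, ?_⟩
    push_cast
    rw [sub_mul, Complex.exp_sub, hpi]
    have hE := Complex.exp_ne_zero (θ * Complex.I)
    generalize Complex.exp (θ * Complex.I) = E at *
    generalize (‖a‖ : ℂ) = α at *
    generalize (‖b‖ : ℂ) = β at *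
    rw [da, db]
    field_simp
  · refine ⟨‖a‖ / ‖b‖, -(Real.pi - θ), by positivity, Or.inr rfl, ?_⟩
    push_cast
    rw [show -((Real.pi : ℂ) - θ) * Complex.I = θ * Complex.I - Real.pi * Complex.I by ring,
      Complex.exp_sub, hpi]
    generalize Complex.exp (θ * Complex.I) = E at *
    generalize (‖a‖ : ℂ) = α at *
    generalize (‖b‖ : ℂ) = β at *
    rw [da, db]
    field_simp
  · refine absurd ⟨?_, ?_⟩ (hne (u * Complex.exp (θ * Complex.I)))
    · rw [← mul_assoc]; exact da
    · rw [← mul_assoc]; exact db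

end Pentagon

/-- Five turning angles between `π / 3` and `π / 2` in absolute value can add up to a full number
of turns only if they all have the same sign. -/
theorem turning_same_sign {τ : Fin 5 → ℝ} (h : ∀ k, Real.pi / 3 < |τ k| ∧ |τ k| < Real.pi / 2)
    {n : ℤ} (hn : ∑ k, τ k = n * (2 * Real.pi)) : (∀ k, 0 < τ k) ∨ ∀ k, τ k < 0 := by
  have hpi := Real.pi_pos
  have cases : ∀ k, (Real.pi / 3 < τ k ∧ τ k < Real.pi / 2) ∨
      (-(Real.pi / 2) < τ k ∧ τ k < -(Real.pi / 3)) := by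
    intro k
    obtain ⟨h1, h2⟩ := h k
    obtain ⟨h3, h4⟩ := abs_lt.1 h2
    rcases lt_abs.1 h1 with h5 | h5
    · exact Or.inl ⟨h5, h4⟩
    · exact Or.inr ⟨h3, by linarith⟩
  have hsum : τ 0 + τ 1 + τ 2 + τ 3 + τ 4 = n * (2 * Real.pi) := by
    rw [← hn, Fin.sum_univ_five]
  -- The five turns total less than `5π/2` in absolute value, which leaves `n` in `{-1, 0, 1}`.
  have hlt : |(n : ℝ)| < 2 := by
    have : |∑ k, τ k| ≤ ∑ k, |τ k| := Finset.abs_sum_le_sum_abs _ _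
    rw [hn, abs_mul, abs_of_pos (by positivity : (0 : ℝ) < 2 * Real.pi),
      Fin.sum_univ_five] at this
    have h0 := (h 0).2
    have h1 := (h 1).2
    have h2 := (h 2).2
    have h3 := (h 3).2
    have h4 := (h 4).2
    by_contra! hc
    nlinarith
  have hn1 : n = -1 ∨ n = 0 ∨ n = 1 := by
    have : |n| < 2 := by exact_mod_cast hlt
    rw [abs_lt] at this
    omega
  simp only [Fin.forall_fin_succ, IsEmpty.forall_iff, and_true, Fin.isValue, Fin.succ_zero_eq_one,
    Fin.succ_one_eq_two]
  change (0 < τ 0 ∧ 0 < τ 1 ∧ 0 < τ 2 ∧ 0 < τ 3 ∧ 0 < τ 4) ∨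
    (τ 0 < 0 ∧ τ 1 < 0 ∧ τ 2 < 0 ∧ τ 3 < 0 ∧ τ 4 < 0)
  -- Total 0 is impossible because the count is odd: three turns of one sign exceed `π` and two of
  -- the other stay below it. Total `±2π` is impossible with a dissenting turn, since four turns
  -- give less than `2π`.
  rcases hn1 with rfl | rfl | rfl <;> push_cast at hsum <;>
  rcases cases 0 with c0 | c0 <;> rcases cases 1 with c1 | c1 <;>
  rcases cases 2 with c2 | c2 <;> rcases cases 3 with c3 | c3 <;>
  rcases cases 4 with c4 | c4 <;>
  first
  | (exfalso; linarith)
  | (left; refine ⟨?_, ?_, ?_, ?_, ?_⟩ <;> linarith)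
  | (right; refine ⟨?_, ?_, ?_, ?_, ?_⟩ <;> linarith)

theorem planeCross_mul_exp (a : ℂ) (ρ τ : ℝ) :
    planeCross a (a * (ρ * Complex.exp (τ * Complex.I))) = ‖a‖ ^ 2 * ρ * Real.sin τ := by
  rw [Complex.exp_mul_I, ← Complex.ofReal_cos, ← Complex.ofReal_sin, Complex.sq_norm,
    Complex.normSq_apply]
  generalize Real.sin τ = s
  generalize Real.cos τ = c
  simp [planeCross]
  ring

theorem closedLength_neg (q : Fin 5 → ℂ) : closedLength (fun k => q (-k)) = closedLength q := by
  have e1 : (-1 : Fin 5) = 4 := rfl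
  have e2 : (-2 : Fin 5) = 3 := rfl
  have e3 : (-3 : Fin 5) = 2 := rfl
  have e4 : (-4 : Fin 5) = 1 := rfl
  simp only [closedLength, Fin.sum_univ_five, Fin.isValue, Fin.reduceAdd, zero_add, e1, e2, e3, e4,
    neg_zero, dist_comm (q 4) (q 0), dist_comm (q 3) (q 4), dist_comm (q 2) (q 3),
    dist_comm (q 1) (q 2), dist_comm (q 0) (q 1)]
  ring

namespace Pentagon

/-- A pentagon of area at least `1` with all angles between `π / 2` and `2 * π / 3` satisfies the
isoperimetric inequality of the regular pentagon. -/
theorem isoperimetric_of_anglesStrictlyBetween (P : Pentagon) (hv : 1 ≤ volume P.carrier)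
    (h : P.AnglesStrictlyBetween (Real.pi / 2) (2 * Real.pi / 3)) :
    20 * √(5 - 2 * √5) ≤ P.poly.pentagonPerimeter ^ 2 := by
  have hpi := Real.pi_pos
  rw [Polygon.pentagonPerimeter_eq]
  have turn : ∀ k, ∃ ρ τ : ℝ, 0 < ρ ∧ (Real.pi / 3 < |τ| ∧ |τ| < Real.pi / 2) ∧
      P.poly (k + 2) - P.poly (k + 1) =
        (P.poly (k + 1) - P.poly k) * (ρ * Complex.exp (τ * Complex.I)) := by
    intro k
    obtain ⟨θ, hθ, h1, h2⟩ := h (k + 1)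
    obtain ⟨ρ, τ, hρ, hτ, e⟩ := P.exists_turning hθ
    have : |τ| = Real.pi - θ := by
      rcases hτ with rfl | rfl
      · exact abs_of_pos (by linarith)
      · rw [abs_neg]; exact abs_of_pos (by linarith)
    exact ⟨ρ, τ, hρ, ⟨by linarith, by linarith⟩, e⟩
  have hne : ∀ k, P.poly (k + 1) - P.poly k ≠ 0 := fun k =>
    sub_ne_zero.2 (P.vertex_ne (by clear * -; revert k; decide))
  set q := P.poly.vertices with hq
  choose ρ τ hρ hτ e using turn
  -- Composing the five rotations and scalings returns the first side to itself. The modulus gives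
  -- product 1 for the ratios, the argument gives the total turning.
  have hprod : (∏ k, (ρ k : ℂ)) * Complex.exp ((∑ k, τ k : ℝ) * Complex.I) = 1 := by
    have e0 := e 0
    have e1 := e 1
    have e2 := e 2
    have e3 := e 3
    have e4 := e 4
    simp only [Fin.isValue, Fin.reduceAdd, zero_add] at e0 e1 e2 e3 e4
    have hn := hne 0
    rw [e3, e2, e1, e0] at e4
    rw [Fin.sum_univ_five, Fin.prod_univ_five]
    push_cast
    simp only [add_mul, Complex.exp_add]
    apply mul_left_cancel₀ hn
    simp only [Fin.isValue, zero_add]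
    nth_rw 2 [e4]
    ring
  obtain ⟨n, hn⟩ : ∃ n : ℤ, ∑ k, τ k = n * (2 * Real.pi) := by
    have hnorm := congrArg norm hprod
    rw [norm_mul, Complex.norm_exp_ofReal_mul_I, norm_prod, norm_one, mul_one] at hnorm
    have h1 : ∏ k, (ρ k : ℂ) = 1 := by
      rw [← Complex.ofReal_prod, ← Complex.ofReal_one, Complex.ofReal_inj, ← hnorm]
      refine Finset.prod_congr rfl fun k _ => ?_
      rw [Complex.norm_real, Real.norm_of_nonneg (hρ k).le]
    rw [h1, one_mul, Complex.exp_eq_one_iff] at hprod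
    obtain ⟨n, hn⟩ := hprod
    refine ⟨n, ?_⟩
    rw [← mul_assoc] at hn
    have := mul_right_cancel₀ Complex.I_ne_zero hn
    exact_mod_cast this
  have c1 : ∀ k, planeCross (q (k + 1) - q k) (q (k + 2) - q (k + 1)) =
      ‖q (k + 1) - q k‖ ^ 2 * ρ k * Real.sin (τ k) := by
    intro k; rw [e k, planeCross_mul_exp]
  have c2 : ∀ k, planeCross (q (k + 1) - q k) (q (k + 3) - q (k + 2)) =
      ‖q (k + 1) - q k‖ ^ 2 * (ρ k * ρ (k + 1)) * Real.sin (τ k + τ (k + 1)) := by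
    intro k
    rw [← planeCross_mul_exp]
    have := e (k + 1)
    rw [show k + 1 + 2 = k + 3 by rw [add_assoc]; rfl,
      show k + 1 + 1 = k + 2 by rw [add_assoc]; rfl, e k] at this
    rw [this]
    push_cast
    rw [add_mul, Complex.exp_add]
    ring_nf
  -- `r` is the path or its reversal, whichever is counterclockwise. The sum of two consecutive
  -- turns stays below `π`, which yields the second sign condition.
  have finish : ∀ r : Fin 5 → ℂ, range r = range q → closedLength r = closedLength q →
      (∀ k, 0 < planeCross (r (k + 1) - r k) (r (k + 2) - r (k + 1))) →
      (∀ k, 0 < planeCross (r (k + 1) - r k) (r (k + 3) - r (k + 2))) →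
      20 * √(5 - 2 * √5) ≤ closedLength q ^ 2 := by
    intro r hr hL h1 h2
    have hA := hv.trans <| (measure_mono P.carrier_subset_convexHull).trans
      (hr ▸ volume_convexHull_le_signedArea h1 h2)
    rw [ENNReal.one_le_ofReal] at hA
    have := signedArea_le_closedLength_sq r
    rw [hL] at this
    refine le_trans ?_ this
    exact le_mul_of_one_le_right (by positivity) hA
  have npos : ∀ k, 0 < ‖q (k + 1) - q k‖ := fun k => norm_pos_iff.2 (hne k)
  rcases turning_same_sign hτ hn with hs | hs
  · have b : ∀ k, Real.pi / 3 < τ k ∧ τ k < Real.pi / 2 := fun k => by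
      have := hτ k; rwa [abs_of_pos (hs k)] at this
    refine finish q rfl rfl (fun k => ?_) (fun k => ?_)
    · rw [c1]
      have := Real.sin_pos_of_pos_of_lt_pi (hs k) (by linarith [(b k).2])
      have := npos k
      have := hρ k
      positivity
    · rw [c2]
      have := Real.sin_pos_of_pos_of_lt_pi (x := τ k + τ (k + 1))
        (by linarith [hs k, hs (k + 1)]) (by linarith [(b k).2, (b (k + 1)).2])
      have := npos k
      have := hρ k
      have := hρ (k + 1)
      positivity
  · have b : ∀ k, Real.pi / 3 < -τ k ∧ -τ k < Real.pi / 2 := fun k => by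
      have := hτ k; rwa [abs_of_neg (hs k)] at this
    have anti : ∀ x y : ℂ, planeCross (-x) (-y) = -planeCross y x := by
      intro x y; simp only [planeCross, Complex.neg_re, Complex.neg_im]; ring
    refine finish (fun k => q (-k)) ?_ (closedLength_neg q) (fun k => ?_) (fun k => ?_)
    · exact (Equiv.neg (Fin 5)).surjective.range_comp q
    · obtain ⟨m, rfl⟩ : ∃ m, k = -(m + 2) := ⟨-(k + 2), by clear * -; revert k; decide⟩
      have i1 : - (-(m + 2) + 1) = m + 1 := by clear * -; revert m; decide
      have i2 : - (-(m + 2) + 2) = m := by clear * -; revert m; decide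
      simp only [i1, i2, neg_neg]
      rw [← neg_sub (q (m + 2)) (q (m + 1)), ← neg_sub (q (m + 1)) (q m), anti, c1, ← mul_neg, ← Real.sin_neg]
      have := Real.sin_pos_of_pos_of_lt_pi (x := -τ m) (by linarith [hs m])
        (by linarith [(b m).2])
      have := npos m
      have := hρ m
      positivity
    · obtain ⟨m, rfl⟩ : ∃ m, k = -(m + 3) := ⟨-(k + 3), by clear * -; revert k; decide⟩
      have i1 : - (-(m + 3) + 1) = m + 2 := by clear * -; revert m; decide
      have i2 : - (-(m + 3) + 2) = m + 1 := by clear * -; revert m; decide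
      have i3 : - (-(m + 3) + 3) = m := by clear * -; revert m; decide
      simp only [i1, i2, i3, neg_neg]
      rw [← neg_sub (q (m + 3)) (q (m + 2)), ← neg_sub (q (m + 1)) (q m), anti, c2, ← mul_neg, ← Real.sin_neg]
      have := Real.sin_pos_of_pos_of_lt_pi (x := -(τ m + τ (m + 1)))
        (by linarith [hs m, hs (m + 1)]) (by linarith [(b m).2, (b (m + 1)).2])
      have := npos m
      have := hρ m
      have := hρ (m + 1)
      positivity

end Pentagon

/-! ### Edges of the tiling and the tiles along them. -/

theorem mem_translateSet {t z : ℂ} {S : Set ℂ} : z ∈ translateSet t S ↔ z - t ∈ S := by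
  constructor
  · rintro ⟨w, hw, rfl⟩; simpa using hw
  · intro h; exact ⟨z - t, h, by simp⟩

theorem interior_translateSet (t : ℂ) (S : Set ℂ) :
    interior (translateSet t S) = translateSet t (interior S) :=
  ((Homeomorph.addLeft t).image_interior S).symm

theorem translateSet_segment (t p q : ℂ) :
    translateSet t (segment ℝ p q) = segment ℝ (t + p) (t + q) :=
  segment_translate_image ℝ t p q

namespace Pentagon

/-- Equal sides with different indices would share both endpoints, while a simple path allows only a
single common vertex. It identifies a side once its tile and translate are known. -/
theorem edgeSet_injective (P : Pentagon) {k l : Fin 5}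
    (h : P.poly.edgeSet ℝ k = P.poly.edgeSet ℝ l) : k = l := by
  by_contra hkl
  have m0 : P.poly k ∈ P.poly.edgeSet ℝ k := by
    rw [Polygon.edgeSet_eq_segment]; exact left_mem_segment ℝ _ _
  have m1 : P.poly (k + 1) ∈ P.poly.edgeSet ℝ k := by
    rw [Polygon.edgeSet_eq_segment]; exact right_mem_segment ℝ _ _
  have a := P.isSimple.2 k l hkl _ ⟨m0, h ▸ m0⟩
  have b := P.isSimple.2 k l hkl _ ⟨m1, h ▸ m1⟩
  simp only [finRotate_apply] at a b
  rcases a with ⟨-, a⟩ | ⟨a, -⟩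
  · exact P.vertex_ne hkl a
  rcases b with ⟨b, -⟩ | ⟨-, b⟩
  · subst b; clear * - a; revert k; decide
  · exact P.vertex_ne (by clear * -; revert k; decide) b

theorem eq_endpoint_of_mem_edgeSet (P : Pentagon) {k l : Fin 5} (hkl : k ≠ l) {z : ℂ}
    (hk : z ∈ P.poly.edgeSet ℝ k) (hl : z ∈ P.poly.edgeSet ℝ l) :
    z = P.poly k ∨ z = P.poly (k + 1) := by
  rcases P.isSimple.2 k l hkl z ⟨hk, hl⟩ with ⟨h, h'⟩ | ⟨-, h'⟩
  · right; rw [h', h, finRotate_apply]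
  · exact Or.inl h'

end Pentagon

/-- Measured from `x`, the parameters of `p` and `q` are nonnegative; if `x` were their midpoint
they would sum to zero. -/
theorem ne_of_segment_eq {p q x y : ℂ} (hpq : p ≠ q) (h : segment ℝ x y = segment ℝ p q) :
    (p + q) / 2 ≠ x := by
  intro hm
  have hp : p ∈ segment ℝ x y := h ▸ left_mem_segment ℝ p q
  have hq : q ∈ segment ℝ x y := h ▸ right_mem_segment ℝ p q
  rw [segment_eq_image'] at hp hq
  obtain ⟨s, ⟨s0, -⟩, hp⟩ := hp
  obtain ⟨s', ⟨s0', -⟩, hq⟩ := hq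
  simp only [Complex.real_smul] at hp hq
  have key : ((s + s' : ℝ) : ℂ) * (y - x) = 0 := by
    push_cast
    linear_combination hp + hq + 2 * hm
  rcases mul_eq_zero.1 key with h0 | h0
  · have h0 : s + s' = 0 := by exact_mod_cast h0
    have e1 : s = 0 := by linarith
    have e2 : s' = 0 := by linarith
    subst e1 e2
    simp at hp hq
    exact hpq (hp.symm.trans hq)
  · rw [h0] at hp hq
    simp at hp hq
    exact hpq (hp.symm.trans hq)

namespace Pentagon

/-- On at least one side of the midpoint of an edge, the nearby points are interior points. -/
theorem exists_interior_near_midpoint (P : Pentagon) {k : Fin 5} {p q : ℂ} (hpq : p ≠ q)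
    (h : P.poly.edgeSet ℝ k = segment ℝ p q) :
    ∃ σ : ℝ, (σ = 1 ∨ σ = -1) ∧ ∃ ε > 0, ∀ s : ℝ, 0 < s → s < ε →
      (p + q) / 2 + ((σ * s : ℝ) : ℂ) * (Complex.I * (q - p)) ∈ interior P.carrier := by
  set m := (p + q) / 2 with hm
  have hmk : m ∈ P.poly.edgeSet ℝ k := by
    rw [h, segment_eq_image']
    exact ⟨1 / 2, by norm_num, by simp [hm]; ring⟩
  have hseg := (P.poly.edgeSet_eq_segment k).symm.trans h
  have hml : ∀ l, l ≠ k → m ∉ P.poly.edgeSet ℝ l := by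
    intro l hl hml
    rcases P.eq_endpoint_of_mem_edgeSet hl.symm hmk hml with e | e
    · exact ne_of_segment_eq hpq hseg e
    · exact ne_of_segment_eq hpq ((segment_symm ℝ _ _).trans hseg) e
  have hopen : IsOpen (⋃ l ∈ ({k}ᶜ : Set (Fin 5)), P.poly.edgeSet ℝ l)ᶜ := by
    refine IsClosed.isOpen_compl (self := (Set.toFinite _).isClosed_biUnion fun l _ => ?_)
    rw [Polygon.edgeSet_eq_segment, ← convexHull_pair]
    exact (Set.toFinite _).isClosed_convexHull ℝ
  obtain ⟨ε, hε, hball⟩ := Metric.isOpen_iff.1 hopen m (by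
    simp only [mem_compl_iff, mem_iUnion, not_exists]
    exact fun l hl => hml l hl)
  have hline : ∀ z ∈ segment ℝ p q, planeCross (q - p) (z - p) = 0 := by
    intro z hz
    rw [segment_eq_image'] at hz
    obtain ⟨s, -, rfl⟩ := hz
    simp [planeCross]; ring
  have hfr : ∀ z ∈ Metric.ball m ε, z ∈ frontier P.carrier → planeCross (q - p) (z - p) = 0 := by
    intro z hz hzf
    rw [P.frontier_eq] at hzf
    obtain ⟨l, hl⟩ := mem_iUnion.1 hzf
    have : l = k := by
      by_contra hlk
      exact hball hz (mem_biUnion hlk hl)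
    subst this
    exact hline z (h ▸ hl)
  have d0 : q - p ≠ 0 := sub_ne_zero.2 hpq.symm
  have shift : ∀ (z : ℂ) (s : ℝ), planeCross (q - p) (z + (s : ℂ) * (Complex.I * (q - p)) - p) =
      planeCross (q - p) (z - p) + s * ‖q - p‖ ^ 2 := by
    intro z s
    rw [Complex.sq_norm, Complex.normSq_apply]
    simp [planeCross]; ring
  -- Near the midpoint the frontier lies on the line of the edge. An open half disc is connected and
  -- misses the frontier, so one point of the region there makes the whole half disc interior.
  have half : ∀ σ : ℝ, (∃ y ∈ Metric.ball m ε, y ∈ P.carrier ∧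
      0 < σ * planeCross (q - p) (y - p)) → ∀ z ∈ Metric.ball m ε,
      0 < σ * planeCross (q - p) (z - p) → z ∈ interior P.carrier := by
    rintro σ ⟨y, hyb, hyc, hy⟩ z hzb hz
    have hconv : Convex ℝ {x | 0 < σ * planeCross (q - p) (x - p)} := by
      intro x hx w hw a b ha hb hab
      simp only [mem_ofPred_eq, planeCross, Complex.sub_re, Complex.sub_im] at hx hw
      simp only [mem_ofPred_eq, planeCross, Complex.sub_re, Complex.sub_im, Complex.add_re,
        Complex.add_im, Complex.real_smul, Complex.re_ofReal_mul, Complex.im_ofReal_mul]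
      obtain rfl : a = 1 - b := by linarith
      rcases hb.eq_or_lt with rfl | hb
      · nlinarith
      · nlinarith [mul_nonneg ha hx.le, mul_pos hb hw]
    have hpre := ((convex_ball m ε).inter hconv).isPreconnected
    have hzS : z ∈ P.carrier := by
      by_contra hzc
      have hcov : ∀ w ∈ Metric.ball m ε ∩ {x | 0 < σ * planeCross (q - p) (x - p)},
          w ∈ P.carrier → w ∈ interior P.carrier := by
        rintro w ⟨hwb, hw⟩ hwc
        by_contra hwi
        have := hfr w hwb ⟨subset_closure hwc, hwi⟩
        simp [this] at hw
      obtain ⟨w, -, hw1, hw2⟩ := hpre (interior P.carrier) P.carrierᶜ isOpen_interior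
        P.isClosed_carrier.isOpen_compl
        (fun w hw => (em (w ∈ P.carrier)).imp (hcov w hw) id)
        ⟨y, ⟨hyb, hy⟩, hcov y ⟨hyb, hy⟩ hyc⟩ ⟨z, ⟨hzb, hz⟩, hzc⟩
      exact hw2 (interior_subset hw1)
    by_contra hzi
    have := hfr z hzb ⟨subset_closure hzS, hzi⟩
    simp [this] at hz
  obtain ⟨y, hyb, hyi⟩ : ∃ y ∈ Metric.ball m ε, y ∈ interior P.carrier := by
    have hmc : m ∈ closure (interior P.carrier) := by
      rw [P.closure_interior]; exact P.edgeSet_subset_carrier k hmk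
    obtain ⟨y, hy, hd⟩ := Metric.mem_closure_iff.1 hmc ε hε
    exact ⟨y, by rwa [Metric.mem_ball, dist_comm], hy⟩
  have hpath : ∀ (z : ℂ) (U : Set ℂ), IsOpen U → z ∈ U → ∃ δ > 0, ∀ s : ℝ, |s| < δ →
      z + (s : ℂ) * (Complex.I * (q - p)) ∈ U := by
    intro z U hU hz
    have hc : Continuous fun s : ℝ => z + (s : ℂ) * (Complex.I * (q - p)) := by fun_prop
    obtain ⟨δ, hδ, hb⟩ := Metric.isOpen_iff.1 (hU.preimage hc) 0 (by simpa using hz)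
    exact ⟨δ, hδ, fun s hs => hb (by simpa using hs)⟩
  have npos : 0 < ‖q - p‖ ^ 2 := pow_pos (norm_pos_iff.2 d0) 2
  obtain ⟨σ, hσ, hyσ⟩ : ∃ σ : ℝ, (σ = 1 ∨ σ = -1) ∧ ∃ y ∈ Metric.ball m ε, y ∈ P.carrier ∧
      0 < σ * planeCross (q - p) (y - p) := by
    rcases lt_trichotomy (planeCross (q - p) (y - p)) 0 with hy | hy | hy
    · exact ⟨-1, Or.inr rfl, y, hyb, interior_subset hyi, by linarith⟩
    -- An interior point on the line can be pushed off it without leaving the interior.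
    · obtain ⟨δ, hδ, hb⟩ := hpath y _ (Metric.isOpen_ball.inter isOpen_interior) ⟨hyb, hyi⟩
      have := hb (δ / 2) (by rw [abs_of_pos (by positivity)]; linarith)
      refine ⟨1, Or.inl rfl, _, this.1, interior_subset this.2, ?_⟩
      rw [shift, hy]; positivity
    · exact ⟨1, Or.inl rfl, y, hyb, interior_subset hyi, by linarith⟩
  obtain ⟨δ, hδ, hb⟩ := hpath m _ Metric.isOpen_ball (Metric.mem_ball_self hε)
  refine ⟨σ, hσ, δ, hδ, fun s hs0 hs => half σ hyσ _ (hb _ ?_) ?_⟩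
  · rcases hσ with rfl | rfl
    · rwa [one_mul, abs_of_pos hs0]
    · rwa [neg_one_mul, abs_neg, abs_of_pos hs0]
  · have hm0 := hline m (h ▸ hmk)
    rw [shift, hm0]
    have : σ * (0 + σ * s * ‖q - p‖ ^ 2) = σ ^ 2 * (s * ‖q - p‖ ^ 2) := by ring
    rw [this]
    have : σ ^ 2 = 1 := by rcases hσ with rfl | rfl <;> norm_num
    rw [this]; positivity

end Pentagon

namespace TorusTiling

variable {Λ : Submodule ℤ ℂ} {N : ℕ}

/-- Different tiles of the lift have no common interior point. -/
theorem eq_of_mem_interiors (T : TorusTiling Λ N) {i j : Fin N} {s t z : ℂ} (hs : s ∈ Λ)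
    (ht : t ∈ Λ) (h1 : z - s ∈ interior (T.tile i).carrier)
    (h2 : z - t ∈ interior (T.tile j).carrier) : i = j ∧ s = t := by
  by_contra hne
  have := T.interiors_disjoint i j (t - s) (Λ.sub_mem ht hs)
    (fun h => hne ⟨h.1, (sub_eq_zero.1 h.2).symm⟩)
  refine this.le_bot ⟨h1, ?_⟩
  rw [interior_translateSet, mem_translateSet]
  simpa using h2

/-- Every edge of the tiling belongs to at most two tiles. -/
theorem card_edge_fiber_le (T : TorusTiling Λ N) (e : Fin N × Fin 5)
    (s : Finset (Fin N × Fin 5)) (hs : ∀ f ∈ s, T.sameEdge e f) : s.card ≤ 2 := by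
  by_contra! hc
  obtain ⟨a, b, c, ha, hb, hc, hab, hac, hbc⟩ := Finset.two_lt_card_iff.1 hc
  set p := (T.tile e.1).poly e.2 with hp
  set q := (T.tile e.1).poly (e.2 + 1) with hq
  have hpq : p ≠ q := (T.tile e.1).vertex_ne (by generalize e.2 = k; revert k; decide)
  -- All sides in the class are compared in the frame of `e`, so that the sign `σ` refers to the
  -- same side of the same segment for every tile.
  have near : ∀ f ∈ s, ∃ t ∈ Λ, T.side f = translateSet t (T.side e) ∧
      ∃ σ : ℝ, (σ = 1 ∨ σ = -1) ∧ ∃ ε > 0, ∀ s : ℝ, 0 < s → s < ε →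
      ((p + q) / 2 + ((σ * s : ℝ) : ℂ) * (Complex.I * (q - p))) - (-t) ∈
        interior (T.tile f.1).carrier := by
    intro f hf
    obtain ⟨t, ht, hft⟩ := hs f hf
    refine ⟨t, ht, hft, ?_⟩
    have hseg : (T.tile f.1).poly.edgeSet ℝ f.2 = segment ℝ (t + p) (t + q) := by
      have h := hft
      unfold side at h
      rw [h, Polygon.edgeSet_eq_segment, translateSet_segment]
    obtain ⟨σ, hσ, ε, hε, H⟩ := (T.tile f.1).exists_interior_near_midpoint (by simpa using hpq) hseg
    refine ⟨σ, hσ, ε, hε, fun s h0 h1 => ?_⟩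
    convert H s h0 h1 using 1
    ring
  have sep : ∀ f g : Fin N × Fin 5, f ≠ g → ∀ t ∈ Λ, ∀ t' ∈ Λ,
      T.side f = translateSet t (T.side e) → T.side g = translateSet t' (T.side e) →
      ∀ σ ε ε' : ℝ, 0 < ε → 0 < ε' → (∀ s : ℝ, 0 < s → s < ε →
      ((p + q) / 2 + ((σ * s : ℝ) : ℂ) * (Complex.I * (q - p))) - (-t) ∈
        interior (T.tile f.1).carrier) → (∀ s : ℝ, 0 < s → s < ε' →
      ((p + q) / 2 + ((σ * s : ℝ) : ℂ) * (Complex.I * (q - p))) - (-t') ∈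
        interior (T.tile g.1).carrier) → False := by
    rintro ⟨i, k⟩ ⟨j, l⟩ hfg t ht t' ht' hf hg σ ε ε' hε hε' H H'
    obtain ⟨r, hr0, hr⟩ := exists_between (lt_min hε hε')
    obtain ⟨h1, h2⟩ := T.eq_of_mem_interiors (Λ.neg_mem ht) (Λ.neg_mem ht')
      (H r hr0 (hr.trans_le (min_le_left _ _))) (H' r hr0 (hr.trans_le (min_le_right _ _)))
    simp only at h1
    subst h1
    obtain rfl : t = t' := neg_injective h2
    have := (T.tile i).edgeSet_injective (hf.trans hg.symm)
    exact hfg (Prod.ext rfl this)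
  obtain ⟨ta, hta, sa, σa, hσa, εa, hεa, Ha⟩ := near a ha
  obtain ⟨tb, htb, sb, σb, hσb, εb, hεb, Hb⟩ := near b hb
  obtain ⟨tc, htc, sc, σc, hσc, εc, hεc, Hc⟩ := near c hc
  -- Pigeonhole: among three signs two agree, and the corresponding tiles would share interior
  -- points.
  by_cases h1 : σa = σb
  · subst h1; exact sep a b hab ta hta tb htb sa sb _ _ _ hεa hεb Ha Hb
  by_cases h2 : σa = σc
  · subst h2; exact sep a c hac ta hta tc htc sa sc _ _ _ hεa hεc Ha Hc
  have h3 : σb = σc := by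
    rcases hσa with rfl | rfl <;> rcases hσb with rfl | rfl <;> rcases hσc with rfl | rfl <;>
      first | rfl | exact absurd rfl h1 | exact absurd rfl h2
  subst h3; exact sep b c hbc tb htb tc htc sb sc _ _ _ hεb hεc Hb Hc

/-- The tile perimeters add up to at most twice the perimeter of the tiling. -/
theorem sum_pentagonPerimeter_le (T : TorusTiling Λ N) :
    ∑ i, (T.tile i).poly.pentagonPerimeter ≤ 2 * T.perimeter := by
  classical
  have : Finite T.Edge := Quotient.finite _
  have := Fintype.ofFinite T.Edge
  set π : Fin N × Fin 5 → T.Edge := Quotient.mk T.sameEdge with hπ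
  have hlen : ∀ e, T.edgeLength (π e) = T.sideLength e := fun e => rfl
  have e1 : ∑ i, (T.tile i).poly.pentagonPerimeter = ∑ e : Fin N × Fin 5, T.sideLength e := by
    rw [Fintype.sum_prod_type]; rfl
  rw [e1, perimeter, finsum_eq_sum_of_fintype, Finset.mul_sum, ← Finset.sum_fiberwise _ π]
  refine Finset.sum_le_sum fun E _ => ?_
  obtain ⟨e, rfl⟩ := Quotient.exists_rep E
  change _ ≤ 2 * T.edgeLength (π e)
  rw [Finset.sum_congr rfl (g := fun _ => T.edgeLength (π e)), Finset.sum_const, nsmul_eq_mul]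
  · have hn : 0 ≤ T.edgeLength (π e) := dist_nonneg
    gcongr
    exact_mod_cast T.card_edge_fiber_le e _ fun f hf =>
      Quotient.exact ((Finset.mem_filter.1 hf).2 : π f = π e).symm
  · intro f hf
    rw [← hlen]
    exact congrArg _ (Finset.mem_filter.1 hf).2

end TorusTiling

/-! ### Sums of angles at the vertices. -/

/-- The measure of a `2π`-periodic set in a period does not depend on the period. -/
theorem volume_periodic_inter_Ioc {B : Set ℝ} (hB : MeasurableSet B)
    (hp : ∀ x, x + 2 * Real.pi ∈ B ↔ x ∈ B) (a b : ℝ) :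
    volume (B ∩ Ioc a (a + 2 * Real.pi)) = volume (B ∩ Ioc b (b + 2 * Real.pi)) := by
  refine (isAddFundamentalDomain_Ioc Real.two_pi_pos a).measure_set_eq
    (isAddFundamentalDomain_Ioc Real.two_pi_pos b) hB ?_
  rintro ⟨_, n, rfl⟩
  have key : Function.Periodic (fun x => x ∈ B) (2 * Real.pi) := fun x => propext (hp x)
  ext x
  have := key.zsmul n x
  simp only [mem_preimage]
  change (n • (2 * Real.pi)) + x ∈ B ↔ x ∈ B
  rw [add_comm]
  exact iff_of_eq this

/-- The directions from a vertex into a region have measure equal to the interior angle. -/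
theorem HasInteriorAngle.eventually_volume_directions {S : Set ℂ} {v : ℂ} {θ : ℝ}
    (h : HasInteriorAngle S v θ) (hS : IsClosed S) :
    ∀ᶠ r : ℝ in nhdsWithin 0 (Ioi 0),
      volume ({φ : ℝ | v + r * Complex.exp (φ * Complex.I) ∈ S} ∩ Ioc 0 (0 + 2 * Real.pi)) ≤
        ENNReal.ofReal θ ∧
      ENNReal.ofReal θ ≤ volume ({φ : ℝ | v + r * Complex.exp (φ * Complex.I) ∈ interior S} ∩
        Ioc 0 (0 + 2 * Real.pi)) := by
  obtain ⟨h0, h2π, u, hu, ε, hε, H⟩ := h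
  filter_upwards [Ioo_mem_nhdsGT hε] with r ⟨hr0, hrε⟩
  have hcont : Continuous fun φ : ℝ => v + r * Complex.exp (φ * Complex.I) := by fun_prop
  have hper : ∀ φ : ℝ, Complex.exp (((φ + 2 * Real.pi : ℝ) : ℂ) * Complex.I) =
      Complex.exp (φ * Complex.I) := by
    intro φ
    rw [Complex.ofReal_add, add_mul, Complex.ofReal_mul, Complex.ofReal_ofNat,
      Complex.exp_periodic]
  obtain ⟨α, hα⟩ : ∃ α : ℝ, u = Complex.exp (α * Complex.I) := by
    have := Complex.norm_mul_exp_arg_mul_I u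
    rw [hu] at this; exact ⟨u.arg, by simpa using this.symm⟩
  have hpt : ∀ φ : ℝ, v + r * Complex.exp (φ * Complex.I) =
      v + r * u * Complex.exp (((φ - α : ℝ) : ℂ) * Complex.I) := by
    intro φ
    rw [hα, mul_assoc, ← Complex.exp_add]; push_cast; ring_nf
  change volume ((fun φ : ℝ => v + r * Complex.exp (φ * Complex.I)) ⁻¹' S ∩ _) ≤ _ ∧
    _ ≤ volume ((fun φ : ℝ => v + r * Complex.exp (φ * Complex.I)) ⁻¹' interior S ∩ _)
  rw [volume_periodic_inter_Ioc (hS.preimage hcont).measurableSet (fun x => by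
      simp only [mem_preimage, hper]) 0 α,
    volume_periodic_inter_Ioc (isOpen_interior.preimage hcont).measurableSet (fun x => by
      simp only [mem_preimage, hper]) 0 α]
  constructor
  -- The endpoint `α + 2π` of the half-open period falls outside the range of angles in `H`; as a
  -- single point it costs no measure.
  · have hsub : (fun φ : ℝ => v + r * Complex.exp (φ * Complex.I)) ⁻¹' S ∩
        Ioc α (α + 2 * Real.pi) ⊆ Icc α (α + θ) ∪ {α + 2 * Real.pi} := by
      rintro φ ⟨h1, h2, h3⟩
      rcases h3.eq_or_lt with h3 | h3
      · exact Or.inr h3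
      · left
        rw [mem_preimage, hpt] at h1
        have := (H r _ hr0 hrε (by linarith) (by linarith)).1 h1
        exact ⟨h2.le, by linarith⟩
    refine (measure_mono hsub).trans ((measure_union_le _ _).trans ?_)
    simp
  · have hsub : Ioo α (α + θ) ⊆ (fun φ : ℝ => v + r * Complex.exp (φ * Complex.I)) ⁻¹'
        interior S ∩ Ioc α (α + 2 * Real.pi) := by
      rintro φ ⟨h1, h2⟩
      refine ⟨?_, h1, by linarith⟩
      rw [mem_preimage, hpt]
      exact mem_interior_of_mem_sector hu H h2π hr0 hrε (by linarith) (by linarith)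
    refine le_trans ?_ (measure_mono hsub)
    simp

/-- Write `x = (1 - r) p + r q`. With `s` and `s'` the parameters of `p` and `q` measured from `x`,
this gives `s (1 - r) + r s' = 0` with nonnegative terms, unless `x = y`. -/
theorem endpoint_of_segment_eq {p q x y : ℂ} (h : segment ℝ x y = segment ℝ p q) :
    x = p ∨ x = q := by
  have hx : x ∈ segment ℝ p q := h ▸ left_mem_segment ℝ x y
  have hp : p ∈ segment ℝ x y := h ▸ left_mem_segment ℝ p q
  have hq : q ∈ segment ℝ x y := h ▸ right_mem_segment ℝ p q
  rw [segment_eq_image'] at hx hp hq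
  obtain ⟨r, ⟨r0, r1⟩, hx⟩ := hx
  obtain ⟨s, ⟨s0, s1⟩, hp⟩ := hp
  obtain ⟨s', ⟨s0', s1'⟩, hq⟩ := hq
  simp only [Complex.real_smul] at hx hp hq
  have key : ((s * (1 - r) + r * s' : ℝ) : ℂ) * (y - x) = 0 := by
    push_cast
    linear_combination (1 - (r : ℂ)) * hp + r * hq + hx
  rcases mul_eq_zero.1 key with h0 | h0
  · have h0 : s * (1 - r) + r * s' = 0 := by exact_mod_cast h0
    have n1 : 0 ≤ s * (1 - r) := mul_nonneg s0 (by linarith)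
    have n2 : 0 ≤ r * s' := mul_nonneg r0 s0'
    have e1 : s * (1 - r) = 0 := by linarith
    have e2 : r * s' = 0 := by linarith
    rcases mul_eq_zero.1 e1 with e | e
    · left; rw [← hp, e]; simp
    · right
      have : s' = 0 := by
        rcases mul_eq_zero.1 e2 with e' | e'
        · linarith
        · exact e'
      rw [← hq, this]; simp
  · left; rw [← hp, h0]; simp

namespace TorusTiling

variable {Λ : Submodule ℤ ℂ} {N : ℕ}

/-- The vertex of the lift at which the corner `c` of a tile is located. -/
def corner (T : TorusTiling Λ N) (c : Fin N × Fin 5) : ℂ := (T.tile c.1).poly c.2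

/-- A tile of the lift that contains a vertex of another tile has a vertex there. -/
theorem exists_corner_of_mem (T : TorusTiling Λ N) {c : Fin N × Fin 5} {z t : ℂ} {j : Fin N}
    (hc : z - T.corner c ∈ Λ) (ht : t ∈ Λ) (hz : z - t ∈ (T.tile j).carrier) :
    ∃ l, z - t = T.corner (j, l) := by
  obtain ⟨i, k⟩ := c
  set s := z - T.corner (i, k) with hs
  have hzs : z - s = (T.tile i).poly k := by rw [hs]; simp [corner]
  by_cases hij : i = j ∧ t - s = 0
  · obtain ⟨rfl, h⟩ := hij
    exact ⟨k, by rw [sub_eq_zero.1 h, hzs]; rfl⟩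
  have hk : (T.tile i).poly k ∈ (T.tile i).poly.edgeSet ℝ k := by
    rw [Polygon.edgeSet_eq_segment]; exact left_mem_segment ℝ _ _
  rcases T.edge_to_edge i j (t - s) (Λ.sub_mem ht hc) hij (z - s)
    ⟨by rw [hzs]; exact (T.tile i).edgeSet_subset_carrier k hk,
      mem_translateSet.2 (by simpa using hz)⟩ with ⟨-, l, -, h⟩ | ⟨k', l, h1, h2⟩
  · exact ⟨l, by rw [corner]; linear_combination h⟩
  · have hend : z - s = (T.tile i).poly k' ∨ z - s = (T.tile i).poly (k' + 1) := by
      by_cases hkk : k' = k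
      · subst hkk; exact Or.inl hzs
      · exact (T.tile i).eq_endpoint_of_mem_edgeSet hkk h1 (hzs ▸ hk)
    rw [Polygon.edgeSet_eq_segment, Polygon.edgeSet_eq_segment, translateSet_segment] at h2
    have : z - s = t - s + (T.tile j).poly l ∨ z - s = t - s + (T.tile j).poly (l + 1) := by
      rcases hend with e | e
      · rw [e]; exact endpoint_of_segment_eq h2
      · rw [e]; exact endpoint_of_segment_eq ((segment_symm ℝ _ _).trans h2)
    rcases this with e | e
    · exact ⟨l, by rw [corner]; linear_combination e⟩
    · exact ⟨l + 1, by rw [corner]; linear_combination e⟩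

/-- The tiles of the lift are locally finite: points close to `z` lie only in tiles that
contain `z`. -/
theorem eventually_mem_tile (T : TorusTiling Λ N) [DiscreteTopology Λ] (z : ℂ) :
    ∀ᶠ w in nhds z, ∀ j, ∀ t ∈ Λ, w - t ∈ (T.tile j).carrier → z - t ∈ (T.tile j).carrier := by
  rw [Filter.eventually_all]
  intro j
  obtain ⟨R, hR⟩ := (T.tile j).isCompact.isBounded.exists_norm_le
  have hcl : IsClosed (Λ : Set ℂ) :=
    @AddSubgroup.isClosed_of_discrete _ _ _ _ _ Λ.toAddSubgroup (inferInstanceAs (DiscreteTopology Λ))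
  -- Only finitely many lattice translates of a bounded tile can reach the unit ball around `z`.
  have hfin : (Metric.closedBall (0 : ℂ) (‖z‖ + 1 + R) ∩ (Λ : Set ℂ)).Finite :=
    Metric.finite_isBounded_inter_isClosed DiscreteTopology.isDiscrete
      Metric.isBounded_closedBall hcl
  have h1 : ∀ᶠ w in nhds z, ∀ t ∈ Metric.closedBall (0 : ℂ) (‖z‖ + 1 + R) ∩ (Λ : Set ℂ),
      w - t ∈ (T.tile j).carrier → z - t ∈ (T.tile j).carrier := by
    rw [Filter.eventually_all_finite hfin]
    intro t _
    by_cases hz : z - t ∈ (T.tile j).carrier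
    · exact Filter.Eventually.of_forall fun _ _ => hz
    · have hc : Continuous fun w : ℂ => w - t := by fun_prop
      filter_upwards [((T.tile j).isClosed_carrier.preimage hc).isOpen_compl.mem_nhds hz] with w hw h
      exact absurd h hw
  filter_upwards [h1, Metric.ball_mem_nhds z one_pos] with w hw hb t ht hwt
  refine hw t ⟨?_, ht⟩ hwt
  rw [mem_closedBall_zero_iff]
  have e1 := hR _ hwt
  have e2 : ‖w - z‖ < 1 := by rwa [Metric.mem_ball, dist_eq_norm] at hb
  calc ‖t‖ = ‖z + (w - z) - (w - t)‖ := by congr 1; ring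
    _ ≤ ‖z + (w - z)‖ + ‖w - t‖ := norm_sub_le _ _
    _ ≤ ‖z‖ + ‖w - z‖ + ‖w - t‖ := by gcongr; exact norm_add_le _ _
    _ ≤ _ := by linarith

/-- The interior angles of different corners at a vertex add up to at most `2π`. -/
theorem sum_angles_le (T : TorusTiling Λ N) {z : ℂ} {F : Finset (Fin N × Fin 5)}
    (hF : ∀ c ∈ F, z - T.corner c ∈ Λ) {θ : Fin N × Fin 5 → ℝ}
    (hθ : ∀ c ∈ F, HasInteriorAngle (T.tile c.1).carrier (T.corner c) (θ c)) :
    ∑ c ∈ F, θ c ≤ 2 * Real.pi := by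
  have hev := (Filter.eventually_all_finset F).2 fun c hc =>
    (hθ c hc).eventually_volume_directions (T.tile c.1).isClosed_carrier
  obtain ⟨r, hr⟩ := hev.exists
  set A : Fin N × Fin 5 → Set ℝ := fun c => {φ : ℝ | T.corner c + r * Complex.exp (φ * Complex.I) ∈
    interior (T.tile c.1).carrier} ∩ Ioc 0 (0 + 2 * Real.pi) with hA
  have hmeas : ∀ c ∈ F, MeasurableSet (A c) := by
    intro c _
    have hcont : Continuous fun φ : ℝ => T.corner c + r * Complex.exp (φ * Complex.I) := by
      fun_prop
    exact (isOpen_interior.preimage hcont).measurableSet.inter measurableSet_Ioc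
  -- Interiors of different tiles of the lift are disjoint, and a single tile has only one corner at
  -- a given point.
  have hdisj : (F : Set (Fin N × Fin 5)).PairwiseDisjoint A := by
    intro c hc d hd hcd
    refine Set.disjoint_left.2 fun φ h1 h2 => hcd ?_
    have h1' : T.corner c + r * Complex.exp (φ * Complex.I) ∈ interior (T.tile c.1).carrier := h1.1
    have h2' : T.corner d + r * Complex.exp (φ * Complex.I) ∈ interior (T.tile d.1).carrier := h2.1
    obtain ⟨e1, e2⟩ := T.eq_of_mem_interiors (i := c.1) (j := d.1) (z := z + r * Complex.exp (φ * Complex.I))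
      (hF c hc) (hF d hd) (by convert h1' using 1; ring) (by convert h2' using 1; ring)
    obtain ⟨i, k⟩ := c
    obtain ⟨j, l⟩ := d
    change i = j at e1
    subst e1
    have e3 : T.corner (i, k) = T.corner (i, l) := by linear_combination -e2
    exact Prod.ext rfl ((T.tile i).isSimple.1 e3)
  have hpos : ∀ c ∈ F, 0 ≤ θ c := fun c hc => (hθ c hc).1.le
  have key : ENNReal.ofReal (∑ c ∈ F, θ c) ≤ ENNReal.ofReal (2 * Real.pi) := by
    rw [ENNReal.ofReal_sum_of_nonneg hpos]
    calc _ ≤ ∑ c ∈ F, volume (A c) := Finset.sum_le_sum fun c hc => (hr c hc).2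
      _ = volume (⋃ c ∈ F, A c) := (measure_biUnion_finset hdisj hmeas).symm
      _ ≤ volume (Ioc (0 : ℝ) (0 + 2 * Real.pi)) :=
          measure_mono (iUnion₂_subset fun c _ => inter_subset_right)
      _ = _ := by simp
  exact (ENNReal.ofReal_le_ofReal_iff Real.two_pi_pos.le).1 key

/-- The interior angles of all corners at a vertex add up to at least `2π`. -/
theorem le_sum_angles (T : TorusTiling Λ N) [DiscreteTopology Λ] {z : ℂ}
    {F : Finset (Fin N × Fin 5)} (hne : F.Nonempty) (hF : ∀ c, c ∈ F ↔ z - T.corner c ∈ Λ)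
    {θ : Fin N × Fin 5 → ℝ}
    (hθ : ∀ c ∈ F, HasInteriorAngle (T.tile c.1).carrier (T.corner c) (θ c)) :
    2 * Real.pi ≤ ∑ c ∈ F, θ c := by
  have hev := (Filter.eventually_all_finset F).2 fun c hc =>
    (hθ c hc).eventually_volume_directions (T.tile c.1).isClosed_carrier
  obtain ⟨ε, hε, hball⟩ := Metric.eventually_nhds_iff_ball.1 (T.eventually_mem_tile z)
  obtain ⟨r, hr, hr0, hrε⟩ := (hev.and (Ioo_mem_nhdsGT hε)).exists
  -- On a small circle around the vertex every point lies in some tile. By local finiteness that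
  -- tile contains the vertex, and by the edge-to-edge condition it has a corner there.
  have hcover : Ioc (0 : ℝ) (0 + 2 * Real.pi) ⊆ ⋃ c ∈ F, {φ : ℝ | T.corner c +
      r * Complex.exp (φ * Complex.I) ∈ (T.tile c.1).carrier} ∩ Ioc 0 (0 + 2 * Real.pi) := by
    intro φ hφ
    obtain ⟨j, t, ht, hw⟩ := T.covers (z + r * Complex.exp (φ * Complex.I))
    rw [mem_translateSet] at hw
    have hz := hball (z + r * Complex.exp (φ * Complex.I)) (by
      rw [Metric.mem_ball, dist_eq_norm, add_sub_cancel_left, norm_mul,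
        Complex.norm_exp_ofReal_mul_I, mul_one, Complex.norm_real, Real.norm_of_nonneg hr0.le]
      exact hrε) j t ht hw
    obtain ⟨c, hc⟩ := hne
    obtain ⟨l, hl⟩ := T.exists_corner_of_mem ((hF c).1 hc) ht hz
    refine mem_biUnion (x := (j, l)) ((hF _).2 ?_) ⟨?_, hφ⟩
    · rw [← hl]; simpa using ht
    · rw [mem_ofPred_eq, ← hl]
      convert hw using 1
      ring
  have hpos : ∀ c ∈ F, 0 ≤ θ c := fun c hc => (hθ c hc).1.le
  refine (ENNReal.ofReal_le_ofReal_iff (Finset.sum_nonneg hpos)).1 ?_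
  calc ENNReal.ofReal (2 * Real.pi) = volume (Ioc (0 : ℝ) (0 + 2 * Real.pi)) := by simp
    _ ≤ _ := measure_mono hcover
    _ ≤ _ := measure_biUnion_finset_le _ _
    _ ≤ ∑ c ∈ F, ENNReal.ofReal (θ c) := Finset.sum_le_sum fun c hc => (hr c hc).1
    _ = _ := (ENNReal.ofReal_sum_of_nonneg hpos).symm

end TorusTiling

/-! ### Counting corners at the vertices of the tiling. -/

namespace TorusTiling

variable {Λ : Submodule ℤ ℂ} {N : ℕ}

/-- The corners of the tiles up to translation in the lattice are the vertices of the tiling. -/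
def sameVertex (T : TorusTiling Λ N) : Setoid (Fin N × Fin 5) where
  r c d := T.corner c - T.corner d ∈ Λ
  iseqv :=
    { refl := fun c => by simp
      symm := fun {c d} h => by simpa using Λ.neg_mem h
      trans := fun {c d e} h h' => by simpa using Λ.add_mem h h' }

open Classical in
/-- At each vertex the corners of convex tiles with angles in `(π / 2, 2π / 3)`, together with
twice the chosen reflex corners, are at most three times as many as the corners of nonconvex
tiles. -/
theorem sum_corner_weights_le (T : TorusTiling Λ N) [DiscreteTopology Λ]
    {θ : Fin N × Fin 5 → ℝ} {ρ : Fin N → Fin 5}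
    (hconv : ∀ c, ¬(T.tile c.1).IsNonconvex →
      HasInteriorAngle (T.tile c.1).carrier (T.corner c) (θ c) ∧
      Real.pi / 2 < θ c ∧ θ c < 2 * Real.pi / 3)
    (hrefl : ∀ c, (T.tile c.1).IsNonconvex → c.2 = ρ c.1 →
      HasInteriorAngle (T.tile c.1).carrier (T.corner c) (θ c) ∧ Real.pi < θ c)
    (e : Fin N × Fin 5) :
    ∑ c with T.sameVertex e c, (if (T.tile c.1).IsNonconvex then
      (if c.2 = ρ c.1 then 2 else 0) else 1 : ℝ) ≤
    ∑ c with T.sameVertex e c, (if (T.tile c.1).IsNonconvex then 3 else 0 : ℝ) := by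
  have hpi := Real.pi_pos
  set s : Finset (Fin N × Fin 5) := {c | T.sameVertex e c} with hs
  have hmem : ∀ c, c ∈ s ↔ T.corner e - T.corner c ∈ Λ := fun c => by
    rw [hs, Finset.mem_filter]; exact and_iff_right (Finset.mem_univ c)
  set m : Fin N × Fin 5 → ℝ := fun c => if (T.tile c.1).IsNonconvex then
      (if c.2 = ρ c.1 then 2 else 0) else 1 with hm
  -- Only these corners have positive weight and a known angle. The remaining corners of nonconvex
  -- tiles are dropped, which is harmless for an upper bound.
  set F := s.filter fun c => (T.tile c.1).IsNonconvex → c.2 = ρ c.1 with hF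
  have hang : ∀ c ∈ F, HasInteriorAngle (T.tile c.1).carrier (T.corner c) (θ c) ∧
      Real.pi / 2 * m c < θ c := by
    intro c hc
    have hc2 := (Finset.mem_filter.1 hc).2
    by_cases h : (T.tile c.1).IsNonconvex
    · obtain ⟨h1, h2⟩ := hrefl c h (hc2 h)
      refine ⟨h1, ?_⟩
      simp only [hm, if_pos h, if_pos (hc2 h)]
      linarith
    · obtain ⟨h1, h2, -⟩ := hconv c h
      refine ⟨h1, ?_⟩
      simp only [hm, if_neg h]
      linarith
  have hsum : ∑ c ∈ s, m c = ∑ c ∈ F, m c := by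
    refine (Finset.sum_filter_of_ne fun c _ hc hN => ?_).symm
    by_contra h'
    simp [hm, hN, h'] at hc
  have hle : ∑ c ∈ s, m c ≤ 3 := by
    rw [hsum]
    rcases F.eq_empty_or_nonempty with h | h
    · rw [h]; simp
    · have h1 : ∑ c ∈ F, Real.pi / 2 * m c < ∑ c ∈ F, θ c :=
        Finset.sum_lt_sum_of_nonempty h fun c hc => (hang c hc).2
      have h2 := T.sum_angles_le (z := T.corner e) (F := F)
        (fun c hc => (hmem c).1 (Finset.mem_filter.1 hc).1) fun c hc => (hang c hc).1
      rw [← Finset.mul_sum] at h1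
      have h3 : ∑ c ∈ F, m c < 4 := by
        by_contra! h4
        nlinarith
      -- The weights are integers, so a total below 4 is at most 3.
      obtain ⟨n, hn⟩ : ∃ n : ℕ, ∑ c ∈ F, m c = n := by
        refine ⟨∑ c ∈ F, if (T.tile c.1).IsNonconvex then (if c.2 = ρ c.1 then 2 else 0) else 1, ?_⟩
        push_cast
        rfl
      rw [hn] at h3 ⊢
      have : n < 4 := by exact_mod_cast h3
      exact_mod_cast Nat.le_of_lt_succ this
  by_cases hex : ∃ c ∈ s, (T.tile c.1).IsNonconvex
  · obtain ⟨c, hc, hN⟩ := hex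
    refine hle.trans ?_
    have := Finset.single_le_sum (f := fun c : Fin N × Fin 5 =>
      (if (T.tile c.1).IsNonconvex then 3 else 0 : ℝ)) (s := s)
      (fun c _ => by positivity) hc
    simpa [hN] using this
  · push Not at hex
    -- Without a nonconvex tile the angles fill `2π`, and each is below `2π/3`, so the weight would
    -- exceed 3.
    exfalso
    have hne : s.Nonempty := ⟨e, (hmem e).2 (by simp)⟩
    have h1 := T.le_sum_angles (z := T.corner e) hne hmem fun c hc => (hconv c (hex c hc)).1
    have h2 : ∑ c ∈ s, θ c < ∑ c ∈ s, 2 * Real.pi / 3 * m c :=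
      Finset.sum_lt_sum_of_nonempty hne fun c hc => by
        simp only [hm, if_neg (hex c hc), mul_one]
        exact (hconv c (hex c hc)).2.2
    rw [← Finset.mul_sum] at h2
    nlinarith

open Classical in
/-- If the angles of all tiles that are not nonconvex lie in `(π / 2, 2π / 3)`, the nonconvex
tiles make up at least `5 / 18` of all tiles. -/
theorem card_convex_le (T : TorusTiling Λ N) [DiscreteTopology Λ]
    (h : ∀ i, (T.tile i).IsNonconvex ∨
      (T.tile i).AnglesStrictlyBetween (Real.pi / 2) (2 * Real.pi / 3)) :
    (5 * Finset.card {i | ¬(T.tile i).IsNonconvex} : ℝ) ≤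
      13 * Finset.card {i | (T.tile i).IsNonconvex} := by
  have hρ : ∀ i, ∃ k, (T.tile i).IsNonconvex →
      ∃ θ, HasInteriorAngle (T.tile i).carrier ((T.tile i).poly k) θ ∧ Real.pi < θ := by
    intro i
    by_cases hi : (T.tile i).IsNonconvex
    · obtain ⟨k, hk⟩ := id hi
      exact ⟨k, fun _ => hk⟩
    · exact ⟨0, fun h => absurd h hi⟩
  choose ρ hρ using hρ
  have hθ : ∀ c : Fin N × Fin 5, ∃ θ, (¬(T.tile c.1).IsNonconvex →
      HasInteriorAngle (T.tile c.1).carrier (T.corner c) θ ∧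
      Real.pi / 2 < θ ∧ θ < 2 * Real.pi / 3) ∧ ((T.tile c.1).IsNonconvex → c.2 = ρ c.1 →
      HasInteriorAngle (T.tile c.1).carrier (T.corner c) θ ∧ Real.pi < θ) := by
    intro c
    by_cases hi : (T.tile c.1).IsNonconvex
    · obtain ⟨θ, hθ⟩ := hρ c.1 hi
      exact ⟨θ, fun h => absurd hi h, fun _ hc => by rw [corner, hc]; exact hθ⟩
    · obtain ⟨θ, hθ⟩ := (h c.1).resolve_left hi c.2
      exact ⟨θ, fun _ => hθ, fun h => absurd h hi⟩
  choose θ hθ using hθ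
  have hle : ∑ c : Fin N × Fin 5, (if (T.tile c.1).IsNonconvex then
      (if c.2 = ρ c.1 then 2 else 0) else 1 : ℝ) ≤
      ∑ c : Fin N × Fin 5, (if (T.tile c.1).IsNonconvex then 3 else 0 : ℝ) := by
    have : Finite (Quotient T.sameVertex) := Quotient.finite _
    have := Fintype.ofFinite (Quotient T.sameVertex)
    rw [← Finset.sum_fiberwise _ (Quotient.mk T.sameVertex)]
    rw [← Finset.sum_fiberwise _ (Quotient.mk T.sameVertex)
      (fun c : Fin N × Fin 5 => (if (T.tile c.1).IsNonconvex then 3 else 0 : ℝ))]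
    refine Finset.sum_le_sum fun E _ => ?_
    obtain ⟨e, rfl⟩ := Quotient.exists_rep E
    have hfib : Finset.univ.filter
        (fun c => Quotient.mk T.sameVertex c = Quotient.mk T.sameVertex e) =
        Finset.univ.filter fun c => T.sameVertex e c :=
      Finset.filter_congr fun c _ => ⟨fun h => T.sameVertex.symm (Quotient.exact h),
        fun h => Quotient.sound (T.sameVertex.symm h)⟩
    have := T.sum_corner_weights_le (fun c => (hθ c).1) (fun c => (hθ c).2) e
    rw [← hfib] at this
    exact this
  -- Regrouped by tiles: a nonconvex tile contributes 2 on the left and 15 on the right, any other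
  -- tile 5 and 0.
  have e1 : ∀ i : Fin N, ∑ k : Fin 5, (if (T.tile i).IsNonconvex then
      (if k = ρ i then 2 else 0) else 1 : ℝ) = if (T.tile i).IsNonconvex then 2 else 5 := by
    intro i; split_ifs <;> simp
  have e2 : ∀ i : Fin N, ∑ k : Fin 5, (if (T.tile i).IsNonconvex then 3 else 0 : ℝ) =
      if (T.tile i).IsNonconvex then 15 else 0 := by
    intro i; split_ifs <;> simp; norm_num
  rw [Fintype.sum_prod_type, Fintype.sum_prod_type] at hle
  simp only [e1, e2] at hle
  rw [Finset.sum_ite, Finset.sum_ite] at hle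
  simp only [Finset.sum_const, nsmul_eq_mul] at hle
  linarith

end TorusTiling

/-! ### The numerical conclusion. -/

theorem proposition2p8 (Λ : Submodule ℤ ℂ) [DiscreteTopology Λ] [IsZLattice ℝ Λ] (N : ℕ)
    (T : TorusTiling Λ N)
    (unit_area : ∀ i, volume (T.tile i).carrier = 1)
    (nonconvex_or_between : ∀ i, (T.tile i).IsNonconvex ∨
      (T.tile i).AnglesStrictlyBetween (Real.pi / 2) (2 * Real.pi / 3)) :
    prismaticPentagon.pentagonPerimeter / 2 < T.perimeterPerTile := by
  classical
  have hN : 0 < (N : ℝ) := by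
    obtain ⟨i, -⟩ := T.covers 0
    exact_mod_cast i.pos
  -- The final inequality has a margin of about 0.00015 per tile, which dictates the precision of
  -- these decimals.
  have h5 : √(5 : ℝ) ≤ 2.2361 := by
    rw [Real.sqrt_le_left (by norm_num)]; norm_num
  have ht : (0.7264 : ℝ) ≤ √(5 - 2 * √5) := by
    apply Real.le_sqrt_of_sq_le; linarith
  have h3 : √(3 : ℝ) ≤ 1.732052 := by
    rw [Real.sqrt_le_left (by norm_num)]; norm_num
  have hP : √(2 + √3) ≤ 1.931855 := by
    rw [Real.sqrt_le_left (by norm_num)]; linarith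
  -- The value 3.8115 comes from `3.8115 ^ 2 < 20 * 0.7264`.
  have hper : ∀ i, (if (T.tile i).IsNonconvex then 4 else 3.8115 : ℝ) ≤
      (T.tile i).poly.pentagonPerimeter := by
    intro i
    split_ifs with hi
    · exact (T.tile i).four_le_perimeter_of_isNonconvex (unit_area i).ge hi
    · have h := (T.tile i).isoperimetric_of_anglesStrictlyBetween (unit_area i).ge
        ((nonconvex_or_between i).resolve_left hi)
      have hp : 0 ≤ (T.tile i).poly.pentagonPerimeter := Finset.sum_nonneg fun _ _ => dist_nonneg
      nlinarith
  have hsum := (Finset.sum_le_sum fun i (_ : i ∈ Finset.univ) => hper i).trans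
    T.sum_pentagonPerimeter_le
  rw [Finset.sum_ite] at hsum
  simp only [Finset.sum_const, nsmul_eq_mul] at hsum
  have hcard := T.card_convex_le nonconvex_or_between
  have htot : (Finset.card {i | (T.tile i).IsNonconvex} : ℝ) +
      Finset.card {i | ¬(T.tile i).IsNonconvex} = N := by
    have := Finset.card_filter_add_card_filter_not (s := Finset.univ)
      (fun i => (T.tile i).IsNonconvex)
    rw [Finset.card_univ, Fintype.card_fin] at this
    exact_mod_cast this
  rw [prismaticPentagon_perimeter, TorusTiling.perimeterPerTile, lt_div_iff₀ hN]
  have : √(2 + √3) * N ≤ 1.931855 * N := by gcongr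
  linarith
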